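/- A polymatroid $\mathsf M=(E,\mathrm{rk})$ is a finite set $E$ with a function $\mathrm{rk}\colon 2^E\to\mathbb Z_{\ge 0}$ that is monotone, submodular and satisfies $\mathrm{rk}(\varnothing)=0$. A flat is a set $F\subseteq E$ with $\mathrm{rk}(F\cup\{e\})>\mathrm{rk}(F)$ for all $e\in E\setminus F$; the flats, ordered by inclusion, form a lattice $\mathcal L(\mathsf M)$ with join $\vee$, and $\mathsf M$ is loopless if $\varnothing$ is a flat. For a flat $F$, the restriction is $\mathsf M|_F=(F,\mathrm{rk}|_{2^F})$ and the contraction is $\mathsf M/F=(E\setminus F,\ A\mapsto \mathrm{rk}(A\cup F)-\mathrm{rk}(F))$. The characteristic polynomial of a loopless $\mathsf M$ is $\chi_{\mathsf M}(x)=\sum_{F\in\mathcal L(\mathsf M)}\mu(\varnothing,F)\,x^{\mathrm{rk}(E)-\mathrm{rk}(F)}$, with $\mu$ the Möbius function of $\mathcal L(\mathsf M)$. For a set $\mathcal G$ of flats, let $f(\mathcal G)$ be the set of its inclusion-maximal elements, and for a flat $F$ put $\mathcal G|_F=\{G\in\mathcal G: G\subseteq F\}$ and $\mathcal G/F=\{G\vee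 F: G\in\mathcal G,\ G\not\subseteq F\}$, where a flat $K\supseteq F$ of $\mathsf M$ is identified with the flat $K\setminus F$ of $\mathsf M/F$. A set $\mathcal G$ of nonempty flats of a loopless polymatroid is a building set if for every flat $F$ the join map $\prod_{G\in f(\mathcal G|_F)}[\varnothing,G]\to[\varnothing,F]$ is an isomorphism of lattices and $\mathrm{rk}(F)=\sum_{G\in f(\mathcal G|_F)}\mathrm{rk}(G)$. (The ground set $E$ need not belong to $\mathcal G$.) The Chow ring $D(\mathsf M,\mathcal G)$ is the quotient of the standard graded polynomial ring $\mathbb Q[x_G: G\in\mathcal G]$ by the ideal generated by $$\Big(\prod_{K\in S}x_K\Big)\Big(\sum_{H\in\mathcal G,\ H\supseteq G}x_H\Big)^{\mathrm{rk}(G)-\mathrm{rk}(\sup(S,G))},\qquad S\subseteq\mathcal G,\ G\in\mathcal G,$$ where $\sup(S,G)$ is the join of all $G'\in S$ with $G'\subsetneq G$. Its Hilbert series is $H_{\mathsf M}^{\mathcal G}(x)=\sum_{i\ge 0}\dim_{\mathbb Q} D^i(\mathsf M,\mathcal G)\,x^i$; in particular it equals $1$ if $E=\varnothing$. **Theorem.**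 Let $\mathsf M$ be a loopless polymatroid on a nonempty ground set $E$, and let $\mathcal G$ be a building set of $\mathsf M$. Then, as formal power series over $\mathbb Q$ (where $1-x$ is invertible), $$H_{\mathsf M}^{\mathcal G}(x)=\sum_{\varnothing\ne F\in\mathcal L(\mathsf M)}\frac{-\chi_{\mathsf M|_F}(x)}{(1-x)^{|f(\mathcal G|_F)|}}\cdot H_{\mathsf M/F}^{\mathcal G/F}(x)$$ and $$H_{\mathsf M}^{\mathcal G}(x)=\sum_{E\ne F\in\mathcal L(\mathsf M)}H_{\mathsf M|_F}^{\mathcal G|_F}(x)\cdot\frac{-\chi_{\mathsf M/F}(x)}{(1-x)^{|f(\mathcal G/F)|}}.$$ -/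

import Mathlib

/-- A polymatroid `(E, rk)` with finite ground set `E = ground`, whose elements are taken from an
ambient type `α`. Only the values of `rk` on subsets of `ground` are meaningful. -/
structure Polymatroid (α : Type*) [DecidableEq α] where
  ground : Finset α
  rk : Finset α → ℕ
  rk_empty : rk ∅ = 0
  rk_mono : ∀ A B : Finset α, A ⊆ B → B ⊆ ground → rk A ≤ rk B
  rk_submod : ∀ A B : Finset α, A ⊆ ground → B ⊆ ground →
    rk (A ∪ B) + rk (A ∩ B) ≤ rk A + rk B

namespace Polymatroid

variable {α : Type*} [DecidableEq α]

/-- `F` is a flat: adding any further element of the ground set strictly increases the rank. -/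
def IsFlat (M : Polymatroid α) (F : Finset α) : Prop :=
  F ⊆ M.ground ∧ ∀ e ∈ M.ground \ F, M.rk F < M.rk (insert e F)

instance (M : Polymatroid α) : DecidablePred M.IsFlat :=
  fun _ => inferInstanceAs (Decidable (_ ∧ _))

/-- The poset `L(M)` of flats, ordered by inclusion. -/
abbrev Flat (M : Polymatroid α) : Type _ := {F : Finset α // M.IsFlat F}

instance (M : Polymatroid α) : Fintype M.Flat :=
  Fintype.subtype (M.ground.powerset.filter M.IsFlat) (by
    intro F
    simp only [Finset.mem_filter, Finset.mem_powerset, and_iff_right_iff_imp]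
    exact fun h => h.1)

/-- Standing assumption on polymatroids: the empty set is a flat. -/
def Loopless (M : Polymatroid α) : Prop := M.IsFlat ∅

/-- The smallest flat containing `A` (for `A ⊆ ground`). In the lattice of flats, the join of a
family of flats is the closure of its union. -/
def cl (M : Polymatroid α) (A : Finset α) : Finset α :=
  M.ground.filter fun e => ∀ F : M.Flat, A ⊆ F.1 → e ∈ F.1

theorem isFlat_cl (M : Polymatroid α) (A : Finset α) : M.IsFlat (M.cl A) := by
  refine ⟨Finset.filter_subset _ _, fun e he => ?_⟩
  have heE := (Finset.mem_sdiff.1 he).1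
  have hne := (Finset.mem_sdiff.1 he).2
  have hex : ∃ F : M.Flat, A ⊆ F.1 ∧ e ∉ F.1 := by
    by_contra hcon
    push Not at hcon
    exact hne (Finset.mem_filter.2 ⟨heE, hcon⟩)
  obtain ⟨F, hAF, heF⟩ := hex
  have hsub : M.cl A ⊆ F.1 := fun x hx => (Finset.mem_filter.1 hx).2 F hAF
  have hcl : M.cl A ⊆ M.ground := Finset.filter_subset _ _
  have h1 := M.rk_submod (insert e (M.cl A)) F.1
    (Finset.insert_subset heE hcl) F.2.1
  have h2 : insert e (M.cl A) ∪ F.1 = insert e F.1 := by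
    rw [Finset.insert_union, Finset.union_eq_right.2 hsub]
  have h3 : insert e (M.cl A) ∩ F.1 = M.cl A := by
    rw [Finset.insert_inter_of_notMem heF, Finset.inter_eq_left.2 hsub]
  have h4 := F.2.2 e (Finset.mem_sdiff.2 ⟨heE, heF⟩)
  rw [h2, h3] at h1
  omega

theorem isLeast_cl (M : Polymatroid α) {A : Finset α} (hA : A ⊆ M.ground) :
    IsLeast {F : Finset α | M.IsFlat F ∧ A ⊆ F} (M.cl A) :=
  ⟨⟨M.isFlat_cl A, fun _ hx => Finset.mem_filter.2 ⟨hA hx, fun _ hF => hF hx⟩⟩,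
    fun F hF _ hx => (Finset.mem_filter.1 hx).2 ⟨F, hF.1⟩ hF.2⟩

/-- The least flat; it is `∅` exactly when `M` is loopless. -/
def botFlat (M : Polymatroid α) : M.Flat := ⟨M.cl ∅, M.isFlat_cl ∅⟩

theorem botFlat_of_loopless (M : Polymatroid α) (hM : M.Loopless) : M.botFlat = ⟨∅, hM⟩ :=
  Subtype.ext (Finset.subset_empty.1
    ((M.isLeast_cl (Finset.empty_subset _)).2 ⟨hM, Finset.Subset.refl _⟩))

/-- The restriction `M|F = (F, rk|_F)`. -/
def restrict (M : Polymatroid α) (F : M.Flat) : Polymatroid α where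
  ground := F.1
  rk := M.rk
  rk_empty := M.rk_empty
  rk_mono A B hAB hB := M.rk_mono A B hAB (hB.trans F.2.1)
  rk_submod A B hA hB := M.rk_submod A B (hA.trans F.2.1) (hB.trans F.2.1)

/-- The contraction `M/F = (E \ F, A ↦ rk (A ∪ F) - rk F)`. -/
def contract (M : Polymatroid α) (F : M.Flat) : Polymatroid α where
  ground := M.ground \ F.1
  rk A := M.rk (A ∪ F.1) - M.rk F.1
  rk_empty := by simp
  rk_mono A B hAB hB := by
    have h := M.rk_mono (A ∪ F.1) (B ∪ F.1) (Finset.union_subset_union_left hAB)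
      (Finset.union_subset (hB.trans Finset.sdiff_subset) F.2.1)
    omega
  rk_submod A B hA hB := by
    have hA' := hA.trans Finset.sdiff_subset
    have hB' := hB.trans Finset.sdiff_subset
    have hAF := Finset.union_subset hA' F.2.1
    have hBF := Finset.union_subset hB' F.2.1
    have h := M.rk_submod (A ∪ F.1) (B ∪ F.1) hAF hBF
    rw [← Finset.union_union_distrib_right, ← Finset.inter_union_distrib_right] at h
    have h1 := M.rk_mono F.1 (A ∪ F.1) Finset.subset_union_right hAF
    have h2 := M.rk_mono F.1 (B ∪ F.1) Finset.subset_union_right hBF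
    have h3 := M.rk_mono F.1 (A ∩ B ∪ F.1) Finset.subset_union_right
      (Finset.union_subset (Finset.inter_subset_left.trans hA') F.2.1)
    have h4 := M.rk_mono F.1 (A ∪ B ∪ F.1) Finset.subset_union_right
      (Finset.union_subset (Finset.union_subset hA' hB') F.2.1)
    omega

/-- The characteristic polynomial `χ_M(x) = ∑_F μ(∅, F) x^(rk E - rk F)`, with `μ` the Möbius
function of the poset of flats. -/
noncomputable def charPoly (M : Polymatroid α) : Polynomial ℚ :=
  ∑ F : M.Flat, Polynomial.C (IncidenceAlgebra.mu ℚ M.botFlat F) *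
    Polynomial.X ^ (M.rk M.ground - M.rk F.1)

/-- `f(𝒢)`: the maximal elements of a family `𝒢`, ordered by inclusion. -/
def factors (𝒢 : Finset (Finset α)) : Finset (Finset α) :=
  𝒢.filter fun G => ∀ H ∈ 𝒢, G ⊆ H → H = G

/-- The induced family `𝒢|F = 𝒢_{≤F} = {G ∈ 𝒢 : G ⊆ F}`. -/
def restrictFamily (𝒢 : Finset (Finset α)) (F : Finset α) : Finset (Finset α) :=
  𝒢.filter fun G => G ⊆ F

/-- The induced family `𝒢/F = {G ∨ F : G ∈ 𝒢, G ⊄ F}`. A flat `K ⊇ F` of `M` corresponds to the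
flat `K \ F` of `M/F`. -/
def contractFamily (M : Polymatroid α) (𝒢 : Finset (Finset α)) (F : Finset α) :
    Finset (Finset α) :=
  (𝒢.filter fun G => ¬ G ⊆ F).image fun G => M.cl (G ∪ F) \ F

/-- The interval `[∅, F]` in the lattice of flats. -/
abbrev FlatsBelow (M : Polymatroid α) (F : Finset α) : Type _ :=
  {X : Finset α // M.IsFlat X ∧ X ⊆ F}

/-- `𝒢` is a building set: it consists of nonempty flats, and for every flat `F` the map
`∏_{G ∈ f(𝒢_{≤F})} [∅, G] → [∅, F]` sending a tuple of flats to its join is an isomorphism (of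
lattices, equivalently of posets), and `rk F` is the sum of the ranks of these `G`. -/
structure IsBuildingSet (M : Polymatroid α) (𝒢 : Finset (Finset α)) : Prop where
  isFlat : ∀ G ∈ 𝒢, M.IsFlat G
  nonempty : ∀ G ∈ 𝒢, G.Nonempty
  join_iso : ∀ F : Finset α, M.IsFlat F →
    ∃ φ : (∀ G : {G // G ∈ factors (restrictFamily 𝒢 F)}, M.FlatsBelow G.1) ≃o M.FlatsBelow F,
      ∀ x, (φ x).1 = M.cl (Finset.univ.biUnion fun G => (x G).1)
  rk_eq : ∀ F : Finset α, M.IsFlat F →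
    M.rk F = ∑ G ∈ factors (restrictFamily 𝒢 F), M.rk G

/-- `sup(S, G)`: the join of all `G' ∈ S` with `G' < G` (the least flat if there are none). -/
def supBelow (M : Polymatroid α) (S : Finset (Finset α)) (G : Finset α) : Finset α :=
  M.cl ((S.filter fun K => K ⊂ G).biUnion id)

/-- The defining ideal of the Chow ring in `ℚ[x_G : G ∈ 𝒢]`, generated by
`(∏_{K ∈ S} x_K) (∑_{H ∈ 𝒢, H ≥ G} x_H) ^ (rk G - rk (sup(S, G)))` for all `S ⊆ 𝒢`, `G ∈ 𝒢`. -/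
noncomputable def chowIdeal (M : Polymatroid α) (𝒢 : Finset (Finset α)) :
    Ideal (MvPolynomial {G // G ∈ 𝒢} ℚ) :=
  Ideal.span {p | ∃ (S : Finset {G // G ∈ 𝒢}) (G : {G // G ∈ 𝒢}),
    p = (∏ K ∈ S, MvPolynomial.X K) *
      (∑ H ∈ Finset.univ.filter (fun H : {G // G ∈ 𝒢} => G.1 ⊆ H.1), MvPolynomial.X H) ^
        (M.rk G.1 - M.rk (M.supBelow (S.image Subtype.val) G.1))}

/-- The Chow ring `D(M, 𝒢)`. -/
abbrev ChowRing (M : Polymatroid α) (𝒢 : Finset (Finset α)) : Type _ :=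
  MvPolynomial {G // G ∈ 𝒢} ℚ ⧸ M.chowIdeal 𝒢

/-- The graded piece `D^i(M, 𝒢)`: the classes of homogeneous polynomials of degree `i`. -/
noncomputable def chowPiece (M : Polymatroid α) (𝒢 : Finset (Finset α)) (i : ℕ) :
    Submodule ℚ (M.ChowRing 𝒢) :=
  (MvPolynomial.homogeneousSubmodule {G // G ∈ 𝒢} ℚ i).map
    (Ideal.Quotient.mkₐ ℚ (M.chowIdeal 𝒢)).toLinearMap

/-- The Hilbert series `∑_{i ≥ 0} dim D^i(M, 𝒢) x^i`. -/
noncomputable def hilbertSeries (M : Polymatroid α) (𝒢 : Finset (Finset α)) : PowerSeries ℚ :=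
  PowerSeries.mk fun i => (Module.finrank ℚ (M.chowPiece 𝒢 i) : ℚ)

/-- `-χ_M(x) / (1 - x) ^ |f(𝒢)|`, as a formal power series (`1 - x` is invertible there). -/
noncomputable def reducedCharSeries (M : Polymatroid α) (𝒢 : Finset (Finset α)) :
    PowerSeries ℚ :=
  -(M.charPoly : PowerSeries ℚ) * ((1 - PowerSeries.X) ^ (factors 𝒢).card)⁻¹

end Polymatroid

/-! The Hilbert series is read off from a monomial basis; one cancellation and one matrix inversion
then give both recursions.

Basis. A monomial with support `S` is standard if its exponent at every `H ∈ 𝒢` is less than `rk H -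
rk (sup (S, H))`. Variables are adjoined from the top of `𝒢` downwards. Let `U` be an upper set, `T`
a set of variables assumed to divide the monomial, and `B` the quotient for `U` relative to `T`.
Adjoining `x_G` with `G` just below `U` gives `B[x_G]` modulo `(x_G + c) ^ d` and `x_G * J`, where
`c` is the sum of the `x_K` with `K > G`, `d = e T G`, and `J` comes from the relations of `U`
relative to `insert G T`. The crucial fact is `c ^ d * J = 0` (`IsChowExponent.pow_mul_mem`): it
splits the new quotient as `B ⊕ x_G (B/J) ⊕ ... ⊕ x_G ^ (d - 1) (B/J)`. Independence is
`IsChowExponent.eq_zero_of_mem`, spanning is `IsChowExponent.restrictSupport_le`. Hence the Hilbert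
series is the sum, over the `T ⊆ 𝒢` for which all drops `d_H = rk H - rk (sup (T, H))`, `H ∈ 𝒢`, are
positive, of `∏_{G ∈ T} (x + ... + x ^ (d_G - 1))` (`IsProductFamily.hilbertSeries_eq`).

Cancellation. The second recursion says that the sum over all flats `F` of `H_{M|F} * χ_{M/F} / (1 -
x) ^ |f(𝒢/F)|` vanishes. Expand `H_{M|F}` and exchange sums: for fixed `T`, the flat `F` runs over
those above the join of `T`. The product structure and Möbius inversion turn the inner sum into a
product over `G ∈ f(𝒢)` of `1` if `G ∈ T` and `-(x + ... + x ^ (d_G - 1))` otherwise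
(`IsProductFamily.sum_contractSeries`, `IsProductFamily.cl_biUnion_inter_factor`). For one fixed `G
∈ f(𝒢)`, the terms of `T` and `insert G T` cancel (`IsProductFamily.sum_nested_eq_zero`).

Inversion. Applied to all minors `(M|B)/A`, the vanishing says that two triangular matrices indexed
by flats have product `1`. They then commute, and the product in the other order is the first
recursion. -/

/-! ### Quotients of polynomial rings by relations indexed by a finite poset -/

section PosetRelations

open MvPolynomial

/-- The properties of the exponents `e S H = rk H - rk (sup (S, H))` on which the computation of
the Hilbert series relies. -/
structure IsChowExponent {σ : Type*} [PartialOrder σ] [DecidableEq σ] (e : Finset σ → σ → ℕ) :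
    Prop where
  antitone : ∀ S T H, S ⊆ T → e T H ≤ e S H
  insert_of_not_lt : ∀ S G H, ¬ G < H → e (insert G S) H = e S H
  insert_le_insert : ∀ S G K H, G < K → K < H → e (insert K S) H ≤ e (insert G S) H
  le_add : ∀ S G H, G < H → e S H ≤ e (insert G S) H + e S G
  -- For a building set `J` is the join of `K` and `H` in the lattice of flats; it belongs to `𝒢`
  -- because `K` and `H` meet in at least the nonempty set `G`.
  exists_join : ∀ G K H, G ≤ K → G ≤ H → ¬ K ≤ H → ¬ H ≤ K →
    ∃ J, (∀ L, J ≤ L ↔ K ≤ L ∧ H ≤ L) ∧ e {K, H} J = 0 ∧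
      ∀ S, e (insert K S) J ≤ e (insert G S) H

variable {σ : Type*} [PartialOrder σ] [Fintype σ] [DecidableEq σ] (k : Type*) [Field k]

open Classical in
/-- The sum of the variables `x_K` with `K ≥ H`. -/
noncomputable def upSum (H : σ) : MvPolynomial σ k := ∑ K with H ≤ K, X K

/-- The ideal of relations among the variables in `U`, with exponents relative to `T`. -/
noncomputable def relIdeal (e : Finset σ → σ → ℕ) (U T : Finset σ) : Ideal (MvPolynomial σ k) :=
  Ideal.span {p | ∃ S ⊆ U, ∃ H ∈ U, p = (∏ K ∈ S, X K) * upSum k H ^ e (S ∪ T) H}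

variable {k} {e : Finset σ → σ → ℕ}

theorem prod_mul_upSum_pow_mem {U T S : Finset σ} {H : σ} {n : ℕ} (hS : S ⊆ U) (hH : H ∈ U)
    (hn : e (S ∪ T) H ≤ n) : (∏ K ∈ S, X K) * upSum k H ^ n ∈ relIdeal k e U T := by
  obtain ⟨m, rfl⟩ := Nat.exists_eq_add_of_le hn
  rw [pow_add, ← mul_assoc]
  exact Ideal.mul_mem_right _ _ (Ideal.subset_span ⟨S, hS, H, hH, rfl⟩)

omit [PartialOrder σ] [Fintype σ] in
theorem prod_mul_mem_of_prod_insert {I : Ideal (MvPolynomial σ k)} {S : Finset σ} {K : σ}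
    {p : MvPolynomial σ k} (h : (∏ L ∈ insert K S, X L) * p ∈ I) :
    X K * ((∏ L ∈ S, X L) * p) ∈ I := by
  by_cases hK : K ∈ S
  · rw [Finset.insert_eq_of_mem hK] at h
    exact Ideal.mul_mem_left _ _ h
  · rwa [Finset.prod_insert hK, mul_assoc] at h

theorem upSum_sub_X (G : σ) [DecidablePred fun K => G < K] :
    upSum k G - X G = ∑ K with G < K, X K := by
  classical
  have : (Finset.univ.filter fun K : σ => G ≤ K)
      = insert G (Finset.univ.filter fun K : σ => G < K) := by
    ext K
    simp [le_iff_lt_or_eq, or_comm, eq_comm]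
  rw [upSum, Finset.filter_congr_decidable, this, Finset.sum_insert (by simp)]
  simp

variable {U : Finset σ} {G : σ}

/-- The difference is the sum of the `x_L` with `L ≥ H` and not `L ≥ K`. Each such `L` is
incomparable to `K`, and both lie above `G`, so `x_K * x_L` is a relation by the vanishing exponent
at their join. -/
theorem IsChowExponent.X_mul_upSum_sub_mem (he : IsChowExponent e) (hU : IsUpperSet (U : Set σ))
    {T : Finset σ} {K H J : σ} (hK : K ∈ U) (hH : H ∈ U) (hGK : G ≤ K) (hGH : G ≤ H)
    (hKH : ¬ H ≤ K) (hJ : ∀ L, J ≤ L ↔ K ≤ L ∧ H ≤ L) :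
    X K * (upSum k H - upSum k J) ∈ relIdeal k e U T := by
  classical
  have hsum : upSum k H - upSum k J = ∑ L with H ≤ L ∧ ¬ K ≤ L, X (R := k) L := by
    rw [sub_eq_iff_eq_add, upSum, upSum, ← Finset.sum_union]
    · refine Finset.sum_congr ?_ fun _ _ => rfl
      ext L
      simp [hJ]
      tauto
    · rw [Finset.disjoint_filter]
      intro L _ h1 h2
      exact h1.2 ((hJ L).1 h2).1
  rw [hsum, Finset.mul_sum]
  refine Ideal.sum_mem _ fun L hL => ?_
  simp only [Finset.mem_filter, Finset.mem_univ, true_and] at hL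
  obtain ⟨J', hJ', h0, -⟩ := he.exists_join G K L hGK (hGH.trans hL.1) hL.2
    fun h => hKH (hL.1.trans h)
  have hLU : L ∈ U := hU hL.1 hH
  have hne : K ≠ L := fun h => hL.2 h.le
  have := prod_mul_upSum_pow_mem (k := k) (e := e) (U := U) (T := T) (S := {K, L}) (H := J') (n := 0)
    (by simp [Finset.insert_subset_iff, hK, hLU]) (hU ((hJ' J').1 le_rfl).1 hK)
    ((he.antitone _ _ _ Finset.subset_union_left).trans h0.le)
  simpa [Finset.prod_pair hne] using this

/-- This is the annihilation `c ^ d * J = 0` on which the basis rests. Against a generator `z` with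
upper sum at `H > G`, the element `c = upSum k G - X G` acts as `upSum k H`, and `le_add` says that
`e T G` further factors of `upSum k H` make up for the exponent lost by inserting `G`. -/
theorem IsChowExponent.pow_mul_mem (he : IsChowExponent e) (hU : IsUpperSet (U : Set σ))
    (hGU : ∀ K, G < K → K ∈ U) {T : Finset σ} {z : MvPolynomial σ k}
    (hz : z ∈ relIdeal k e U (insert G T)) :
    (upSum k G - X G) ^ e T G * z ∈ relIdeal k e U T := by
  classical
  refine Submodule.span_induction (fun z hz => ?_) (by simp) (fun x y _ _ hx hy => ?_)
    (fun a x _ hx => ?_) hz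
  · obtain ⟨S, hS, H, hH, rfl⟩ := hz
    rw [Finset.union_insert]
    by_cases hGH : G < H
    · set a := e (insert G (S ∪ T)) H with ha
      set z := (∏ K ∈ S, X K) * upSum k H ^ a with hz
      -- The terms of the difference are the `x_K` with `K > G` and not `K ≥ H`. If `K < H`, then
      -- `K` replaces `G` in the support; otherwise `K` and `H` are incomparable, and `upSum k H` is
      -- exchanged for the upper sum at their join.
      have hkey : (upSum k G - X G - upSum k H) * z ∈ relIdeal k e U T := by
        have hsum : upSum k G - X G - upSum k H = ∑ K with G < K ∧ ¬ H ≤ K, X (R := k) K := by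
          rw [upSum_sub_X, sub_eq_iff_eq_add, upSum, ← Finset.sum_union]
          · refine Finset.sum_congr ?_ fun _ _ => rfl
            ext L
            have : H ≤ L → G < L := hGH.trans_le
            simp
            tauto
          · rw [Finset.disjoint_filter]
            exact fun L _ h1 h2 => h1.2 h2
        rw [hsum, Finset.sum_mul]
        refine Ideal.sum_mem _ fun K hK => ?_
        simp only [Finset.mem_filter, Finset.mem_univ, true_and] at hK
        have hKU := hGU K hK.1
        by_cases hKH : K < H
        · exact prod_mul_mem_of_prod_insert (prod_mul_upSum_pow_mem
            (Finset.insert_subset hKU hS) hH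
            (by rw [Finset.insert_union]; exact he.insert_le_insert _ _ _ _ hK.1 hKH))
        · have hKH' : ¬ K ≤ H := fun h => (h.lt_or_eq).elim hKH fun h => hK.2 h.ge
          obtain ⟨J, hJ, -, hJe⟩ := he.exists_join G K H hK.1.le hGH.le hKH' hK.2
          have h1 : X K * ((∏ L ∈ S, X L) * upSum k J ^ a) ∈ relIdeal k e U T :=
            prod_mul_mem_of_prod_insert (prod_mul_upSum_pow_mem
              (Finset.insert_subset hKU hS) (hU ((hJ J).1 le_rfl).1 hKU)
              (by rw [Finset.insert_union]; exact hJe _))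
          have h2 : X K * z - X K * ((∏ L ∈ S, X L) * upSum k J ^ a) ∈ relIdeal k e U T := by
            obtain ⟨q, hq⟩ := sub_dvd_pow_sub_pow (upSum k H) (upSum k J) a
            have := he.X_mul_upSum_sub_mem (k := k) (T := T) hU hKU hH hK.1.le hGH.le hK.2 hJ
            have := Ideal.mul_mem_right ((∏ L ∈ S, X L) * q) _ this
            convert this using 1
            rw [hz]
            linear_combination (X K * ∏ L ∈ S, X L) * hq
          exact (Submodule.sub_mem_iff_left _ h1).1 h2
      obtain ⟨q, hq⟩ := sub_dvd_pow_sub_pow (upSum k G - X G) (upSum k H) (e T G)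
      have h1 : ((upSum k G - X G) ^ e T G - upSum k H ^ e T G) * z ∈ relIdeal k e U T := by
        rw [hq, mul_assoc, mul_left_comm]
        exact Ideal.mul_mem_left _ _ hkey
      have h2 : upSum k H ^ e T G * z ∈ relIdeal k e U T := by
        have : upSum k H ^ e T G * z = (∏ K ∈ S, X K) * upSum k H ^ (a + e T G) := by
          rw [hz, pow_add]; ring
        rw [this]
        refine prod_mul_upSum_pow_mem hS hH ((he.le_add _ _ _ hGH).trans ?_)
        exact Nat.add_le_add_left (he.antitone _ _ _ Finset.subset_union_right) _
      rw [sub_mul] at h1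
      exact (Submodule.sub_mem_iff_left _ h2).1 h1
    · rw [he.insert_of_not_lt _ _ _ hGH]
      exact Ideal.mul_mem_left _ _ (prod_mul_upSum_pow_mem hS hH le_rfl)
  · rw [mul_add]
    exact add_mem hx hy
  · rw [smul_eq_mul, mul_left_comm]
    exact Ideal.mul_mem_left _ _ hx

end PosetRelations

/-! ### Division by a monic polynomial whose constant term is annihilated by an ideal -/

section ModByMonic

open Polynomial

variable {B : Type*} [CommRing B] {J : Ideal B} {f : B[X]}

/-- One step of division by `f`: a multiple of `f` by an element of `J` is subtracted from `X * r`.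
The new constant term is a multiple of `j * f.coeff 0` with `j ∈ J`, hence zero. -/
theorem exists_X_mul_eq_of_coeff_mem (hf : f.Monic) (hd : 0 < f.natDegree)
    (hJ : ∀ j ∈ J, j * f.coeff 0 = 0) {r : B[X]} (hr : r.degree < f.degree)
    (hrJ : ∀ i, r.coeff i ∈ J) :
    ∃ q r', X * r = f * q + r' ∧ r'.degree < f.degree ∧ r'.coeff 0 = 0 ∧ ∀ i, r'.coeff i ∈ J := by
  have : Nontrivial B := by
    by_contra h
    rw [not_nontrivial_iff_subsingleton] at h
    simp [Subsingleton.elim f 0] at hd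
  obtain ⟨n, hn⟩ := Nat.exists_eq_succ_of_ne_zero hd.ne'
  rw [degree_eq_natDegree hf.ne_zero, hn] at hr ⊢
  refine ⟨C (r.coeff n), X * r - f * C (r.coeff n), by ring, ?_, ?_, ?_⟩
  · rw [degree_lt_iff_coeff_zero] at hr ⊢
    intro m hm
    obtain ⟨m, rfl⟩ := Nat.exists_eq_succ_of_ne_zero (by omega : m ≠ 0)
    rw [coeff_sub, coeff_mul_C, Nat.succ_eq_add_one, coeff_X_mul]
    rcases (Nat.lt_or_ge n m) with h | h
    · rw [hr m (by omega), coeff_eq_zero_of_natDegree_lt (by omega)]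
      simp
    · obtain rfl : m = n := by omega
      have := hf.coeff_natDegree
      rw [hn] at this
      simp [this]
  · rw [coeff_sub, coeff_mul_C, mul_comm (f.coeff 0), hJ _ (hrJ n)]
    simp
  · rintro (_ | i)
    · simpa using J.mul_mem_left _ (hrJ n)
    · rw [coeff_sub, coeff_mul_C, coeff_X_mul]
      exact sub_mem (hrJ i) (J.mul_mem_left _ (hrJ n))

/-- If `J` annihilates the constant coefficient of the monic polynomial `f`, then the polynomials
of degree less than `deg f` in the ideal generated by `f` and `X * J` are those with coefficients
in `J` and constant coefficient zero. -/
theorem coeff_mem_of_mem_span (hf : f.Monic) (hd : 0 < f.natDegree)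
    (hJ : ∀ j ∈ J, j * f.coeff 0 = 0) {p : B[X]}
    (hp : p ∈ Ideal.span ({f} ∪ {q | ∃ j ∈ J, q = X * C j})) (hdeg : p.degree < f.degree) :
    p.coeff 0 = 0 ∧ ∀ i, p.coeff i ∈ J := by
  -- Remainders with coefficients in `J` and zero constant term are stable under multiplication by
  -- scalars and, after division by `f`, by `X`; so every element of the ideal has such a remainder.
  -- Below degree `deg f` an element is its own remainder.
  have key : ∃ q r, p = f * q + r ∧ r.degree < f.degree ∧ r.coeff 0 = 0 ∧ ∀ i, r.coeff i ∈ J := by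
    refine Submodule.span_induction ?_ ?_ ?_ ?_ hp
    · rintro p (rfl | ⟨j, hj, rfl⟩)
      · exact ⟨1, 0, by simp, by simpa [bot_lt_iff_ne_bot] using (by rintro rfl; simp at hd), by simp,
          by simp⟩
      · refine exists_X_mul_eq_of_coeff_mem hf hd hJ ?_ fun i => ?_
        · exact degree_C_le.trans_lt (natDegree_pos_iff_degree_pos.1 hd)
        · rw [coeff_C]
          split_ifs
          exacts [hj, J.zero_mem]
    · exact ⟨0, 0, by simp, by simpa [bot_lt_iff_ne_bot] using (by rintro rfl; simp at hd), by simp,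
          by simp⟩
    · rintro _ _ _ _ ⟨q, r, rfl, hr, h0, h⟩ ⟨q', r', rfl, hr', h0', h'⟩
      refine ⟨q + q', r + r', by ring, (degree_add_le _ _).trans_lt (max_lt hr hr'), ?_, fun i => ?_⟩
      · simp [h0, h0']
      · rw [coeff_add]
        exact add_mem (h i) (h' i)
    · rintro a _ _ ⟨q, r, rfl, hr, h0, h⟩
      suffices ∀ a : B[X], ∀ r : B[X], r.degree < f.degree → r.coeff 0 = 0 → (∀ i, r.coeff i ∈ J) →
          ∃ q r', a * r = f * q + r' ∧ r'.degree < f.degree ∧ r'.coeff 0 = 0 ∧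
            ∀ i, r'.coeff i ∈ J by
        obtain ⟨q', r', h1, h2⟩ := this a r hr h0 h
        exact ⟨a * q + q', r', by rw [smul_eq_mul, mul_add, h1]; ring, h2⟩
      intro a
      induction a using Polynomial.induction_on' with
      | add a b ha hb =>
        intro r hr h0 h
        obtain ⟨q, s, h1, hs, hs0, hsJ⟩ := ha r hr h0 h
        obtain ⟨q', s', h1', hs', hs0', hsJ'⟩ := hb r hr h0 h
        refine ⟨q + q', s + s', by rw [add_mul, h1, h1']; ring,
          (degree_add_le _ _).trans_lt (max_lt hs hs'), by simp [hs0, hs0'], fun i => ?_⟩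
        rw [coeff_add]
        exact add_mem (hsJ i) (hsJ' i)
      | monomial n b =>
        induction n with
        | zero =>
          intro r hr h0 h
          refine ⟨0, C b * r, by simp, by
            rw [← smul_eq_C_mul]; exact (degree_smul_le _ _).trans_lt hr, by simp [h0], fun i => ?_⟩
          rw [coeff_C_mul]
          exact J.mul_mem_left _ (h i)
        | succ n ih =>
          intro r hr h0 h
          obtain ⟨q, s, h1, hs, hs0, hsJ⟩ := ih r hr h0 h
          obtain ⟨q', s', h1', h2⟩ := exists_X_mul_eq_of_coeff_mem hf hd hJ hs hsJ
          refine ⟨X * q + q', s', ?_, h2⟩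
          rw [← monomial_mul_X, mul_right_comm, h1, add_mul, mul_comm s X, h1']
          ring
  obtain ⟨q, r, rfl, hr, h0, h⟩ := key
  have hlt : (f * q).degree < f.degree := by
    have := (degree_sub_le (f * q + r) r).trans_lt (max_lt hdeg hr)
    simpa using this
  obtain rfl : q = 0 := by
    by_contra hq
    rw [hf.degree_mul_comm, hf.degree_mul] at hlt
    have : (0 : WithBot ℕ) ≤ q.degree := by simpa [zero_le_degree_iff] using hq
    exact absurd hlt (not_lt.2 (le_add_of_nonneg_left this))
  simpa using ⟨h0, h⟩

end ModByMonic

/-! ### Linear independence of the standard monomials -/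

section StandardMonomials

open MvPolynomial

variable {σ : Type*} [PartialOrder σ] [DecidableEq σ]

/-- The exponents of the standard monomials for the relations among the variables in `U`. -/
def stdExponents (e : Finset σ → σ → ℕ) (U T : Finset σ) : Set (σ →₀ ℕ) :=
  {m | m.support ⊆ U ∧ ∀ H ∈ U, m H < e (m.support ∪ T) H}

variable {e : Finset σ → σ → ℕ}

theorem IsChowExponent.union_of_forall_not_lt (he : IsChowExponent e) {S T : Finset σ} {G : σ}
    (hS : ∀ K ∈ S, ¬ K < G) : e (S ∪ T) G = e T G := by
  induction S using Finset.induction_on with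
  | empty => simp
  | insert K S _ ih =>
    rw [Finset.insert_union, he.insert_of_not_lt _ _ _ (hS K (Finset.mem_insert_self _ _)),
      ih fun L hL => hS L (Finset.mem_insert_of_mem hL)]

/-- Nothing in `insert G U` lies below `G`, so the bound at `G` depends on `T` alone; the other
variables see `G` as a member of `T` exactly when `x_G` occurs. This is the combinatorial form of
the splitting into `B` and copies of `B/J`. -/
theorem mem_stdExponents_insert (he : IsChowExponent e) {U T : Finset σ} {G : σ}
    (hU : IsUpperSet (U : Set σ)) (hG : G ∉ U) {m : σ →₀ ℕ} :
    m ∈ stdExponents e (insert G U) T ↔ m G < e T G ∧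
      m.erase G ∈ stdExponents e U (if m G = 0 then T else insert G T) := by
  have hnot : ∀ K ∈ insert G U, ¬ K < G := fun K hK h => by
    rcases Finset.mem_insert.1 hK with rfl | hK
    exacts [lt_irrefl _ h, hG (hU h.le hK)]
  have hsupp : (m.erase G).support ∪ (if m G = 0 then T else insert G T) = m.support ∪ T := by
    rw [Finsupp.support_erase]
    split_ifs with h
    · rw [Finset.erase_eq_of_notMem (by simpa using h)]
    · rw [Finset.union_insert, ← Finset.insert_union, Finset.insert_erase (by simpa using h)]
  have hsub : (m.erase G).support ⊆ U ↔ m.support ⊆ insert G U := by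
    rw [Finsupp.support_erase, Finset.subset_insert_iff]
  simp only [stdExponents, Set.mem_ofPred_eq, hsupp, hsub]
  constructor
  · rintro ⟨h1, h2⟩
    refine ⟨?_, h1, fun H hH => ?_⟩
    · rw [← he.union_of_forall_not_lt fun K hK => hnot K (h1 hK)]
      exact h2 G (Finset.mem_insert_self _ _)
    · rw [Finsupp.erase_ne (by rintro rfl; exact hG hH)]
      exact h2 H (Finset.mem_insert_of_mem hH)
  · rintro ⟨h1, h2, h3⟩
    refine ⟨h2, fun H hH => ?_⟩
    rcases Finset.mem_insert.1 hH with rfl | hHU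
    · rwa [he.union_of_forall_not_lt fun K hK => hnot K (h2 hK)]
    · rw [← Finsupp.erase_ne (f := m) (a := G) (by rintro rfl; exact hG hHU)]
      exact h3 H hHU

/-- A minimal element can be removed from an upper set, so upper sets are built from the top. -/
theorem upperSet_finset_induction {P : Finset σ → Prop} (empty : P ∅)
    (insert : ∀ (U : Finset σ) (G : σ), IsUpperSet (U : Set σ) → G ∉ U → (∀ K, G < K → K ∈ U) → P U → P (insert G U))
    (U : Finset σ) (hU : IsUpperSet (U : Set σ)) : P U := by
  induction U using Finset.strongInduction with
  | H U ih =>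
    rcases U.eq_empty_or_nonempty with rfl | hne
    · exact empty
    · obtain ⟨G, hG⟩ := U.exists_minimal hne
      have hU' : IsUpperSet (U.erase G : Set σ) := by
        intro a b hab ha
        simp only [Finset.coe_erase, Set.mem_sdiff, Finset.mem_coe, Set.mem_singleton_iff] at ha ⊢
        refine ⟨hU hab ha.1, ?_⟩
        rintro rfl
        exact ha.2 (le_antisymm hab (hG.2 ha.1 hab))
      rw [← Finset.insert_erase hG.1]
      refine insert _ _ hU' (Finset.notMem_erase _ _) (fun K hK => ?_)
        (ih _ (Finset.erase_ssubset hG.1) hU')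
      exact Finset.mem_erase.2 ⟨hK.ne', hU hK.le hG.1⟩

variable [Fintype σ] (k : Type*) [Field k]

theorem relIdeal_mono (he : IsChowExponent e) {U U' T T' : Finset σ} (hU : U ⊆ U') (hT : T ⊆ T') :
    relIdeal k e U T ≤ relIdeal k e U' T' := by
  refine Ideal.span_le.2 ?_
  rintro _ ⟨S, hS, H, hH, rfl⟩
  exact prod_mul_upSum_pow_mem (hS.trans hU) (hU hH)
    (he.antitone _ _ _ (Finset.union_subset_union_right hT))

/-- Evaluation of polynomials in which the variable `x_G` is kept and the others are reduced. -/
noncomputable def splitVar (I : Ideal (MvPolynomial σ k)) (G : σ) :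
    MvPolynomial σ k →ₐ[k] Polynomial (MvPolynomial σ k ⧸ I) :=
  aeval fun K => if K = G then Polynomial.X else Polynomial.C (Ideal.Quotient.mk I (X K))

omit [PartialOrder σ] [Fintype σ] in
theorem splitVar_X_of_ne (I : Ideal (MvPolynomial σ k)) {G K : σ} (h : K ≠ G) :
    splitVar k I G (X K) = Polynomial.C (Ideal.Quotient.mk I (X K)) := by
  simp [splitVar, h]

omit [PartialOrder σ] [Fintype σ] in
theorem splitVar_X_self (I : Ideal (MvPolynomial σ k)) (G : σ) :
    splitVar k I G (X G) = Polynomial.X := by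
  simp [splitVar]

omit [PartialOrder σ] [Fintype σ] in
theorem splitVar_monomial (I : Ideal (MvPolynomial σ k)) (G : σ) (m : σ →₀ ℕ) (a : k) :
    splitVar k I G (monomial m a) = Polynomial.monomial (m G)
      (Ideal.Quotient.mk I (monomial (m.erase G) a)) := by
  have h1 : ∀ m : σ →₀ ℕ, m G = 0 → splitVar k I G (monomial m a)
      = Polynomial.C (Ideal.Quotient.mk I (monomial m a)) := by
    intro m hm
    rw [splitVar, aeval_monomial, monomial_eq, Finsupp.prod, Finsupp.prod]
    simp only [map_mul, map_prod, map_pow]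
    congr 1
    refine Finset.prod_congr rfl fun K hK => ?_
    rw [if_neg]
    rintro rfl
    exact (Finsupp.mem_support_iff.1 hK) hm
  have h2 : monomial m a = X G ^ m G * monomial (m.erase G) a := by
    rw [X_pow_eq_monomial, monomial_mul, one_mul, Finsupp.single_add_erase]
  rw [h2, map_mul, map_pow, splitVar_X_self, h1 _ (by simp), ← Polynomial.C_mul_X_pow_eq_monomial]
  exact Polynomial.X_pow_mul_C _ _

/-- Each generator falls into one of three cases: for `H = G` it becomes a multiple of the monic
polynomial, for `H ≠ G` and `G ∈ S` a multiple of `X * J`, and otherwise zero in the coefficient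
ring. -/
theorem splitVar_mem (he : IsChowExponent e) {U T : Finset σ} {G : σ}
    (hU : IsUpperSet (U : Set σ)) (hG : G ∉ U) (hGU : ∀ K, G < K → K ∈ U)
    {p : MvPolynomial σ k} (hp : p ∈ relIdeal k e (insert G U) T) :
    splitVar k (relIdeal k e U T) G p ∈ Ideal.span
      ({(Polynomial.X + Polynomial.C (Ideal.Quotient.mk _ (upSum k G - X G))) ^ e T G} ∪
        {q | ∃ j ∈ (relIdeal k e U (insert G T)).map (Ideal.Quotient.mk (relIdeal k e U T)),
          q = Polynomial.X * Polynomial.C j}) := by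
  classical
  have hprod : ∀ S ⊆ U, splitVar k (relIdeal k e U T) G (∏ K ∈ S, X K)
      = Polynomial.C (Ideal.Quotient.mk _ (∏ K ∈ S, X K)) := by
    intro S hS
    simp only [map_prod]
    exact Finset.prod_congr rfl fun K hK =>
      splitVar_X_of_ne k _ (by rintro rfl; exact hG (hS hK))
  have hup : ∀ H ∈ U, splitVar k (relIdeal k e U T) G (upSum k H)
      = Polynomial.C (Ideal.Quotient.mk _ (upSum k H)) := by
    intro H hH
    simp only [upSum, map_sum]
    refine Finset.sum_congr rfl fun K hK => splitVar_X_of_ne k _ ?_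
    rintro rfl
    exact hG (hU (by simpa using hK) hH)
  have hupG : splitVar k (relIdeal k e U T) G (upSum k G)
      = Polynomial.X + Polynomial.C (Ideal.Quotient.mk _ (upSum k G - X G)) := by
    rw [← sub_add_cancel (upSum k G) (X G), map_add, splitVar_X_self, add_comm, add_sub_cancel_right,
      upSum_sub_X, map_sum, map_sum, map_sum]
    congr 1
    refine Finset.sum_congr rfl fun K hK => splitVar_X_of_ne k _ ?_
    rintro rfl
    simp at hK
  rw [← Ideal.mem_comap]
  refine Ideal.span_le.2 ?_ hp
  rintro _ ⟨S, hS, H, hH, rfl⟩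
  rw [SetLike.mem_coe, Ideal.mem_comap, map_mul, map_pow]
  rcases Finset.mem_insert.1 hH with rfl | hHU
  · rw [hupG, he.union_of_forall_not_lt fun K hK h => ?_]
    · exact Ideal.mul_mem_left _ _ (Ideal.subset_span (Or.inl rfl))
    · rcases Finset.mem_insert.1 (hS hK) with rfl | hK
      exacts [lt_irrefl _ h, hG (hU h.le hK)]
  · rw [hup H hHU]
    by_cases hGS : G ∈ S
    · have hS' : S.erase G ⊆ U := Finset.subset_insert_iff.1 hS
      rw [← Finset.mul_prod_erase _ _ hGS, map_mul, splitVar_X_self, hprod _ hS', mul_assoc,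
        ← map_pow, ← map_pow, ← map_mul, ← map_mul]
      refine Ideal.subset_span (Or.inr ⟨_, Ideal.mem_map_of_mem _ ?_, rfl⟩)
      refine prod_mul_upSum_pow_mem hS' hHU (le_of_eq ?_)
      rw [Finset.union_insert, ← Finset.insert_union, Finset.insert_erase hGS]
    · have hS' : S ⊆ U := (Finset.subset_insert_iff_of_notMem hGS).1 hS
      rw [hprod _ hS', ← map_pow, ← map_pow, ← map_mul, ← map_mul]
      have : Ideal.Quotient.mk (relIdeal k e U T) ((∏ K ∈ S, X K) * upSum k H ^ e (S ∪ T) H) = 0 :=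
        Ideal.Quotient.eq_zero_iff_mem.2 (prod_mul_upSum_pow_mem hS' hHU le_rfl)
      rw [this, map_zero]
      exact Ideal.zero_mem _

/-- The standard monomials are linearly independent modulo the relations. -/
theorem IsChowExponent.eq_zero_of_mem (he : IsChowExponent e) (U : Finset σ)
    (hU : IsUpperSet (U : Set σ)) : ∀ (T : Finset σ) (p : MvPolynomial σ k),
      (∀ m ∈ p.support, m ∈ stdExponents e U T) → p ∈ relIdeal k e U T → p = 0 := by
  classical
  revert U
  apply upperSet_finset_induction
  · intro T p _ hp
    simpa [relIdeal] using hp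
  · intro U G hU hG hGU ih T p hstd hp
    by_contra hp0
    obtain ⟨m₀, hm₀⟩ := Finset.nonempty_of_ne_empty (mt support_eq_empty.1 hp0)
    have hd : 0 < e T G := (Nat.zero_le _).trans_lt
      ((mem_stdExponents_insert he hU hG).1 (hstd m₀ hm₀)).1
    set I := relIdeal k e U T with hI
    set c := Ideal.Quotient.mk I (upSum k G - X G) with hc
    set f := (Polynomial.X + Polynomial.C c) ^ e T G with hf
    have hfm : f.Monic := (Polynomial.monic_X_add_C c).pow _
    -- Since some monomial is standard, so is `1`, for `U` and `T`; by induction `1` is not in the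
    -- ideal.
    have hnontriv : Nontrivial (MvPolynomial σ k ⧸ I) := by
      refine Ideal.Quotient.nontrivial_iff.2 fun htop => ?_
      have hz : (0 : σ →₀ ℕ) ∈ stdExponents e U T := by
        have h := ((mem_stdExponents_insert he hU hG).1 (hstd m₀ hm₀)).2
        refine ⟨by simp, fun H hH => ?_⟩
        refine (Nat.zero_le _).trans_lt ((h.2 H hH).trans_le (he.antitone _ _ _ ?_))
        refine Finset.union_subset (by simp) (Finset.Subset.trans ?_ Finset.subset_union_right)
        split_ifs <;> simp
      have := ih T 1 (fun m hm => by
        rw [← C_1, C_apply] at hm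
        rw [Finset.mem_singleton.1 (support_monomial_subset hm)]
        exact hz) (by rw [← hI, htop]; trivial)
      exact one_ne_zero this
    have hfd : f.natDegree = e T G := by
      rw [hf, (Polynomial.monic_X_add_C c).natDegree_pow, Polynomial.natDegree_X_add_C, mul_one]
    have hann : ∀ j ∈ (relIdeal k e U (insert G T)).map (Ideal.Quotient.mk I),
        j * f.coeff 0 = 0 := by
      intro j hj
      obtain ⟨z, hz, rfl⟩ := (Ideal.mem_map_iff_of_surjective _ Ideal.Quotient.mk_surjective).1 hj
      rw [hf, Polynomial.coeff_zero_eq_eval_zero]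
      simp only [Polynomial.eval_pow, Polynomial.eval_add, Polynomial.eval_X, Polynomial.eval_C,
        zero_add]
      rw [hc, ← map_pow, ← map_mul, mul_comm]
      exact Ideal.Quotient.eq_zero_iff_mem.2 (he.pow_mul_mem hU hGU hz)
    -- `part i` is the coefficient of `x_G ^ i` in `p`, as a polynomial in the remaining variables.
    set part : ℕ → MvPolynomial σ k := fun i =>
      ∑ m ∈ p.support with m G = i, monomial (m.erase G) (coeff m p) with hpart
    have hsplit : ∀ i, (splitVar k I G p).coeff i = Ideal.Quotient.mk I (part i) := by
      intro i
      conv_lhs => rw [p.as_sum]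
      rw [map_sum, Polynomial.finsetSum_coeff, hpart, map_sum, Finset.sum_filter]
      refine Finset.sum_congr rfl fun m _ => ?_
      rw [splitVar_monomial, Polynomial.coeff_monomial]
    have hcoeff : ∀ m ∈ p.support, coeff (m.erase G) (part (m G)) = coeff m p := by
      intro m hm
      simp only [hpart, coeff_sum, coeff_monomial]
      rw [Finset.sum_eq_single m]
      · simp
      · intro m' hm' hne
        rw [if_neg]
        intro h
        refine hne ?_
        rw [← Finsupp.single_add_erase G m', h, (Finset.mem_filter.1 hm').2,
          Finsupp.single_add_erase]
      · exact fun h => absurd hm fun hm => h (by simpa using hm)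
    have hsupp : ∀ i, ∀ m ∈ (part i).support, ∃ m' ∈ p.support, m' G = i ∧ m'.erase G = m := by
      intro i m hm
      have := Finset.mem_of_subset (support_sum (f := fun m : σ →₀ ℕ => monomial (m.erase G) (coeff m p))) hm
      obtain ⟨m', hm', h⟩ := Finset.mem_biUnion.1 this
      rw [Finset.mem_filter] at hm'
      exact ⟨m', hm'.1, hm'.2, (Finset.mem_singleton.1 (support_monomial_subset h)).symm⟩
    have hdeg : (splitVar k I G p).degree < f.degree := by
      rw [Polynomial.degree_eq_natDegree hfm.ne_zero, hfd, Polynomial.degree_lt_iff_coeff_zero]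
      intro i hi
      rw [hsplit]
      have : part i = 0 := Finset.sum_eq_zero fun m hm => ?_
      · rw [this, map_zero]
      rw [Finset.mem_filter] at hm
      have := ((mem_stdExponents_insert he hU hG).1 (hstd m hm.1)).1
      omega
    obtain ⟨h0, hJ⟩ := coeff_mem_of_mem_span hfm (hfd ▸ hd) hann
      (splitVar_mem k he hU hG hGU hp) hdeg
    -- The constant term vanishes in `B`, so induction applies with `T`; the higher coefficients
    -- only lie in `J`, that is, vanish in `B/J`, and induction applies with `insert G T`.
    have hzero : ∀ i, part i = 0 := by
      rintro (_ | i)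
      · refine ih T _ (fun m hm => ?_) ?_
        · obtain ⟨m', hm', h1, rfl⟩ := hsupp _ m hm
          simpa [h1] using ((mem_stdExponents_insert he hU hG).1 (hstd m' hm')).2
        · rw [hsplit] at h0
          exact Ideal.Quotient.eq_zero_iff_mem.1 h0
      · refine ih (insert G T) _ (fun m hm => ?_) ?_
        · obtain ⟨m', hm', h1, rfl⟩ := hsupp _ m hm
          simpa [h1] using ((mem_stdExponents_insert he hU hG).1 (hstd m' hm')).2
        · have := hJ (i + 1)
          rw [hsplit, Ideal.mem_quotient_iff_mem
            (relIdeal_mono k he subset_rfl (Finset.subset_insert _ _))] at this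
          exact this
    have := hcoeff m₀ hm₀
    rw [hzero, coeff_zero] at this
    exact mem_support_iff.1 hm₀ this.symm

end StandardMonomials

/-! ### Spanning by standard monomials and the Hilbert function -/

section HilbertFunction

open MvPolynomial

variable {σ : Type*} [PartialOrder σ] [DecidableEq σ] [Fintype σ] (k : Type*) [Field k]
variable {e : Finset σ → σ → ℕ}

omit [PartialOrder σ] [DecidableEq σ] [Fintype σ] in
theorem mul_mem_restrictSupport_degree {U : Finset σ} {a b n : ℕ} {p q : MvPolynomial σ k}
    (hp : p ∈ restrictSupport k {m : σ →₀ ℕ | m.support ⊆ U ∧ m.degree = a})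
    (hq : q ∈ restrictSupport k {m : σ →₀ ℕ | m.support ⊆ U ∧ m.degree = b}) (hn : a + b = n) :
    p * q ∈ restrictSupport k {m : σ →₀ ℕ | m.support ⊆ U ∧ m.degree = n} := by
  classical
  have h := Submodule.mul_mem_mul hp hq
  rw [← restrictSupport_add] at h
  refine restrictSupport_mono _ ?_ h
  rintro _ ⟨x, hx, y, hy, rfl⟩
  refine ⟨Finsupp.support_add.trans (Finset.union_subset hx.1 hy.1), ?_⟩
  rw [map_add, hx.2, hy.2, hn]

omit [PartialOrder σ] [DecidableEq σ] [Fintype σ] in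
theorem pow_mem_restrictSupport_degree {U : Finset σ} {p : MvPolynomial σ k}
    (hp : p ∈ restrictSupport k {m : σ →₀ ℕ | m.support ⊆ U ∧ m.degree = 1}) (n : ℕ) :
    p ^ n ∈ restrictSupport k {m : σ →₀ ℕ | m.support ⊆ U ∧ m.degree = n} := by
  induction n with
  | zero =>
    rw [pow_zero, ← C_1, C_apply, monomial_mem_restrictSupport]
    left
    simp
  | succ n ih =>
    rw [pow_succ]
    exact mul_mem_restrictSupport_degree k ih hp rfl

theorem X_mul_mem_relIdeal {U T : Finset σ} {G : σ} {z : MvPolynomial σ k}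
    (hz : z ∈ relIdeal k e U (insert G T)) : X G * z ∈ relIdeal k e (insert G U) T := by
  refine Submodule.span_induction (fun z hz => ?_) (by simp) (fun x y _ _ hx hy => ?_)
    (fun a x _ hx => ?_) hz
  · obtain ⟨S, hS, H, hH, rfl⟩ := hz
    refine prod_mul_mem_of_prod_insert (prod_mul_upSum_pow_mem (Finset.insert_subset_insert _ hS)
      (Finset.mem_insert_of_mem hH) ?_)
    rw [Finset.insert_union, Finset.union_insert]
  · rw [mul_add]
    exact add_mem hx hy
  · rw [smul_eq_mul, mul_left_comm]
    exact Ideal.mul_mem_left _ _ hx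

/-- The standard monomials span the polynomial ring modulo the relations. -/
theorem IsChowExponent.restrictSupport_le (he : IsChowExponent e) (U : Finset σ)
    (hU : IsUpperSet (U : Set σ)) : ∀ (T : Finset σ) (n : ℕ),
      restrictSupport k {m : σ →₀ ℕ | m.support ⊆ U ∧ m.degree = n} ≤
        restrictSupport k {m : σ →₀ ℕ | m ∈ stdExponents e U T ∧ m.degree = n} ⊔
          (relIdeal k e U T).restrictScalars k := by
  classical
  revert U
  apply upperSet_finset_induction
  · intro T n
    refine le_sup_of_le_left (restrictSupport_mono _ ?_)
    rintro m ⟨h1, h2⟩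
    exact ⟨⟨h1, by simp⟩, h2⟩
  · intro U G hU hG hGU ih T n
    by_cases hd : e T G = 0
    · have h1 : (1 : MvPolynomial σ k) ∈ relIdeal k e (insert G U) T := by
        simpa using prod_mul_upSum_pow_mem (k := k) (e := e) (T := T) (n := 0)
          (Finset.empty_subset (insert G U)) (Finset.mem_insert_self G U) (by simp [hd])
      rw [(Ideal.eq_top_iff_one _).2 h1]
      intro p _
      exact Submodule.mem_sup_right (by simp)
    set c := upSum k G - X (R := k) G with hc
    have hcmem : c ∈ restrictSupport k {m : σ →₀ ℕ | m.support ⊆ U ∧ m.degree = 1} := by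
      rw [hc, upSum_sub_X]
      refine Submodule.sum_mem _ fun K hK => ?_
      rw [X, monomial_mem_restrictSupport]
      left
      refine ⟨Finsupp.support_single_subset.trans ?_, by simp⟩
      simpa using hGU K (by simpa using hK)
    -- For `0 < j` the rest of the monomial may be reduced by the larger ideal relative to `insert G
    -- T`, because `x_G` times that ideal lies in the relations for `insert G U`.
    have hsmall : ∀ j < e T G, ∀ n, ∀ p ∈ restrictSupport k
        {m : σ →₀ ℕ | m.support ⊆ U ∧ m.degree = n}, X G ^ j * p ∈
          restrictSupport k {m : σ →₀ ℕ | m ∈ stdExponents e (insert G U) T ∧ m.degree = n + j} ⊔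
            (relIdeal k e (insert G U) T).restrictScalars k := by
      intro j hj n p hp
      obtain ⟨w, hw, z, hz, rfl⟩ := Submodule.mem_sup.1 (ih (if j = 0 then T else insert G T) n hp)
      rw [mul_add]
      refine Submodule.add_mem_sup ?_ ?_
      · rw [restrictSupport_eq_span] at hw
        refine Submodule.span_induction ?_ (by simp) (fun x y _ _ hx hy => ?_)
          (fun a x _ hx => ?_) hw
        · rintro _ ⟨m, ⟨hm, hdeg⟩, rfl⟩
          have hmG : m G = 0 := Finsupp.notMem_support_iff.1 fun h => hG (hm.1 h)
          simp only [X_pow_eq_monomial, monomial_mul, one_mul, monomial_mem_restrictSupport]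
          left
          refine ⟨(mem_stdExponents_insert he hU hG).2 ?_, ?_⟩
          · have h1 : (Finsupp.single G j + m) G = j := by simp [hmG]
            have h2 : (Finsupp.single G j + m).erase G = m := by
              rw [Finsupp.erase_add, Finsupp.erase_single, zero_add,
                Finsupp.erase_of_notMem_support (by simpa using hmG)]
            rw [h1, h2]
            exact ⟨hj, hm⟩
          · rw [map_add, hdeg, Finsupp.degree_single, add_comm]
        · rw [mul_add]
          exact add_mem hx hy
        · rw [mul_smul_comm]
          exact Submodule.smul_mem _ _ hx
      · rw [Submodule.restrictScalars_mem] at hz ⊢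
        rcases j with _ | j
        · rw [pow_zero, one_mul]
          exact relIdeal_mono k he (Finset.subset_insert _ _) subset_rfl hz
        · rw [pow_succ, mul_assoc]
          exact Ideal.mul_mem_left _ _ (X_mul_mem_relIdeal k hz)
    -- The relation `(x_G + c) ^ e T G`, with `c` in the variables of `U`, rewrites a high power of
    -- `x_G` through lower ones of the same total degree.
    have hall : ∀ j, ∀ n, ∀ p ∈ restrictSupport k
        {m : σ →₀ ℕ | m.support ⊆ U ∧ m.degree = n}, X G ^ j * p ∈
          restrictSupport k {m : σ →₀ ℕ | m ∈ stdExponents e (insert G U) T ∧ m.degree = n + j} ⊔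
            (relIdeal k e (insert G U) T).restrictScalars k := by
      intro j
      induction j using Nat.strong_induction_on with
      | _ j ihj =>
        intro n p hp
        rcases Nat.lt_or_ge j (e T G) with hj | hj
        · exact hsmall j hj n p hp
        obtain ⟨l, rfl⟩ := Nat.exists_eq_add_of_le' hj
        have hy : upSum k G ^ e T G ∈ relIdeal k e (insert G U) T := by
          simpa using prod_mul_upSum_pow_mem (k := k) (e := e) (T := T) (n := e T G)
            (Finset.empty_subset (insert G U)) (Finset.mem_insert_self G U) (by simp)
        have hexp : X G ^ (l + e T G) * p = X G ^ l * p * upSum k G ^ e T G -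
            ∑ i ∈ Finset.range (e T G),
              X G ^ (l + i) * ((((e T G).choose i : k) • c ^ (e T G - i)) * p) := by
          have : upSum k G = X G + c := by rw [hc]; ring
          rw [this, add_pow, Finset.sum_range_succ, mul_add, Finset.mul_sum, add_sub_right_comm,
            ← Finset.sum_sub_distrib, Finset.sum_eq_zero, zero_add]
          · simp [pow_add]
            ring
          · intro i _
            rw [smul_eq_C_mul, map_natCast]
            ring
        rw [hexp]
        refine Submodule.sub_mem _ (Submodule.mem_sup_right ?_) (Submodule.sum_mem _ fun i hi => ?_)
        · rw [Submodule.restrictScalars_mem]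
          exact Ideal.mul_mem_left _ _ hy
        · have hi' := Finset.mem_range.1 hi
          have := ihj (l + i) (by omega) (n + (e T G - i)) _ (mul_mem_restrictSupport_degree k
            (Submodule.smul_mem _ ((e T G).choose i : k)
              (pow_mem_restrictSupport_degree k hcmem (e T G - i))) hp (add_comm _ _))
          rwa [show n + (e T G - i) + (l + i) = n + (l + e T G) by omega] at this
    rw [restrictSupport_eq_span, Submodule.span_le]
    rintro _ ⟨m, ⟨hm, rfl⟩, rfl⟩
    have hdeg : (m.erase G).degree + m G = m.degree := by
      conv_rhs => rw [← Finsupp.single_add_erase G m]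
      rw [map_add, Finsupp.degree_single, add_comm]
    have := hall (m G) (m.erase G).degree (monomial (m.erase G) 1) (by
      rw [monomial_mem_restrictSupport]
      left
      refine ⟨?_, rfl⟩
      rw [Finsupp.support_erase]
      exact Finset.subset_insert_iff.1 hm)
    rwa [hdeg, X_pow_eq_monomial, monomial_mul, one_mul, Finsupp.single_add_erase] at this

/-- The Hilbert function of the quotient by the relations counts the standard monomials. -/
theorem IsChowExponent.finrank_map_homogeneousSubmodule (he : IsChowExponent e) (n : ℕ) :
    Module.finrank k ((homogeneousSubmodule σ k n).map
      (Ideal.Quotient.mkₐ k (relIdeal k e Finset.univ ∅)).toLinearMap) =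
        {m : σ →₀ ℕ | m ∈ stdExponents e Finset.univ ∅ ∧ m.degree = n}.ncard := by
  classical
  set q := (Ideal.Quotient.mkₐ k (relIdeal k e Finset.univ ∅)).toLinearMap with hq
  set W := restrictSupport k {m : σ →₀ ℕ | m ∈ stdExponents e Finset.univ ∅ ∧ m.degree = n} with hW
  have hker : ∀ p, q p = 0 ↔ p ∈ relIdeal k e Finset.univ ∅ := fun p =>
    Ideal.Quotient.eq_zero_iff_mem
  have hmap : (homogeneousSubmodule σ k n).map q = W.map q := by
    apply le_antisymm
    · rw [Submodule.map_le_iff_le_comap]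
      intro p hp
      rw [homogeneousSubmodule_eq_finsupp_supported] at hp
      obtain ⟨w, hw, z, hz, rfl⟩ := Submodule.mem_sup.1
        (he.restrictSupport_le k Finset.univ (by simpa using isUpperSet_univ) ∅ n
          (restrictSupport_mono k (s := {m | m.degree = n})
            (t := {m : σ →₀ ℕ | m.support ⊆ Finset.univ ∧ m.degree = n})
            (fun m hm => ⟨Finset.subset_univ _, hm⟩) hp))
      refine ⟨w, hw, ?_⟩
      rw [map_add, (hker z).2 hz, add_zero]
    · refine Submodule.map_mono ?_
      rw [homogeneousSubmodule_eq_finsupp_supported]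
      exact restrictSupport_mono k fun m hm => hm.2
  have hinj : Function.Injective (q ∘ₗ W.subtype) := by
    rw [injective_iff_map_eq_zero]
    rintro ⟨p, hp⟩ h
    refine Subtype.ext (he.eq_zero_of_mem k Finset.univ (by simpa using isUpperSet_univ) ∅ p
      (fun m hm => ?_) ((hker p).1 h))
    exact ((mem_restrictSupport_iff k).1 hp hm).1
  rw [hmap]
  have hr : W.map q = LinearMap.range (q ∘ₗ W.subtype) := by
    rw [LinearMap.range_comp, Submodule.range_subtype]
  rw [hr, LinearMap.finrank_range_of_inj hinj,
    Module.finrank_eq_nat_card_basis (basisRestrictSupport k _), Nat.card_coe_set_eq]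

-- Group the standard monomials by their support `S`. On `S` the exponent at `G` runs from `1` to `e
-- S G - 1`; off `S` it is `0`, and the strict bound there leaves the condition `0 < e S H`.
omit [PartialOrder σ] in
theorem sum_ncard_stdExponents :
    (PowerSeries.mk fun n =>
      (({m : σ →₀ ℕ | m ∈ stdExponents e Finset.univ ∅ ∧ m.degree = n}.ncard : ℕ) : k)) =
    ∑ S : Finset σ with ∀ H, 0 < e S H,
      ∏ G ∈ S, ∑ i ∈ Finset.Ico 1 (e S G), (PowerSeries.X : PowerSeries k) ^ i := by
  classical
  set box : Finset σ → Finset (σ → ℕ) := fun S =>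
    Fintype.piFinset fun G => if G ∈ S then Finset.Ico 1 (e S G) else {0} with hbox
  have hmem : ∀ S g, g ∈ box S ↔ (∀ G ∈ S, 1 ≤ g G ∧ g G < e S G) ∧ ∀ G ∉ S, g G = 0 := by
    intro S g
    simp only [hbox, Fintype.mem_piFinset]
    constructor
    · intro h
      refine ⟨fun G hG => ?_, fun G hG => ?_⟩
      · simpa [hG] using h G
      · simpa [hG] using h G
    · rintro ⟨h1, h2⟩ G
      by_cases hG : G ∈ S
      · simpa [hG] using h1 G hG
      · simpa [hG] using h2 G hG
  have hsupp : ∀ S g, g ∈ box S → Finset.univ.filter (fun G => g G ≠ 0) = S := by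
    intro S g hg
    rw [hmem] at hg
    ext G
    by_cases hG : G ∈ S
    · have := (hg.1 G hG).1
      simp [hG]
      omega
    · simp [hG, hg.2 G hG]
  have hprod : ∀ S : Finset σ, (∏ G ∈ S, ∑ i ∈ Finset.Ico 1 (e S G),
      (PowerSeries.X : PowerSeries k) ^ i) = ∑ g ∈ box S, PowerSeries.X ^ ∑ G, g G := by
    intro S
    have h1 : ∀ g : σ → ℕ, (PowerSeries.X : PowerSeries k) ^ ∑ G, g G
        = ∏ G, PowerSeries.X ^ g G := fun g => (Finset.prod_pow_eq_pow_sum _ _ _).symm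
    simp only [h1, hbox]
    rw [← Finset.prod_univ_sum, ← Finset.prod_subset (Finset.subset_univ S)]
    · exact Finset.prod_congr rfl fun G hG => by simp [hG]
    · intro G _ hG
      simp [hG]
  have hset : ∀ n, {m : σ →₀ ℕ | m ∈ stdExponents e Finset.univ ∅ ∧ m.degree = n} =
      Finsupp.equivFunOnFinite.symm '' (((Finset.univ.filter fun S : Finset σ => ∀ H, 0 < e S H).biUnion
        fun S => (box S).filter fun g => ∑ G, g G = n : Finset (σ → ℕ)) : Set (σ → ℕ)) := by
    intro n
    rw [Equiv.image_eq_preimage_symm, Equiv.symm_symm]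
    ext m
    simp only [stdExponents, Finset.subset_univ, Finset.mem_univ, true_and, forall_const,
      Finset.union_empty, Set.mem_ofPred_eq, Finset.coe_biUnion, Set.mem_preimage, Set.mem_iUnion,
      Finset.mem_coe, Finset.mem_filter, Finsupp.equivFunOnFinite_apply]
    rw [Finsupp.degree_eq_sum]
    constructor
    · rintro ⟨h1, h2⟩
      refine ⟨m.support, fun H => (Nat.zero_le _).trans_lt (h1 H), ?_, h2⟩
      rw [hmem]
      refine ⟨fun G hG => ⟨Nat.one_le_iff_ne_zero.2 (Finsupp.mem_support_iff.1 hG), h1 G⟩,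
        fun G hG => Finsupp.notMem_support_iff.1 hG⟩
    · rintro ⟨S, hS, hm, h2⟩
      refine ⟨fun H => ?_, h2⟩
      have : m.support = S := by
        rw [← hsupp S _ hm]
        ext
        simp
      rw [this]
      rw [hmem] at hm
      by_cases hH : H ∈ S
      · exact (hm.1 H hH).2
      · have h0 := hm.2 H hH
        rw [Finsupp.equivFunOnFinite_apply] at h0
        exact h0 ▸ hS H
  ext n
  rw [PowerSeries.coeff_mk, hset, Set.ncard_image_of_injective _ (Equiv.injective _),
    Set.ncard_coe_finset, Finset.card_biUnion, map_sum, Nat.cast_sum]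
  · refine Finset.sum_congr rfl fun S _ => ?_
    rw [hprod, map_sum, Finset.card_filter, Nat.cast_sum]
    refine Finset.sum_congr rfl fun g _ => ?_
    rw [PowerSeries.coeff_X_pow]
    simp [eq_comm]
  · intro S _ S' _ hne
    rw [Function.onFun, Finset.disjoint_left]
    intro g hg hg'
    exact hne ((hsupp S g (Finset.mem_filter.1 hg).1).symm.trans
      (hsupp S' g (Finset.mem_filter.1 hg').1))

end HilbertFunction

/-! ### Closure and rank -/

namespace Polymatroid

section Closure

variable {α : Type*} [DecidableEq α] (M : Polymatroid α) {A B F X : Finset α}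

theorem cl_subset_ground : M.cl A ⊆ M.ground := Finset.filter_subset _ _

variable {M}

theorem subset_cl (hA : A ⊆ M.ground) : A ⊆ M.cl A := (M.isLeast_cl hA).1.2

theorem cl_subset (hF : M.IsFlat F) (h : A ⊆ F) : M.cl A ⊆ F :=
  fun _ hx => (Finset.mem_filter.1 hx).2 ⟨F, hF⟩ h

theorem cl_mono (h : A ⊆ B) : M.cl A ⊆ M.cl B := fun _ hx =>
  Finset.mem_filter.2 ⟨(Finset.mem_filter.1 hx).1,
    fun F hF => (Finset.mem_filter.1 hx).2 F (h.trans hF)⟩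

theorem IsFlat.cl_eq (hF : M.IsFlat F) : M.cl F = F :=
  (cl_subset hF subset_rfl).antisymm (subset_cl hF.1)

theorem cl_subset_cl (h : A ⊆ M.cl B) : M.cl A ⊆ M.cl B := cl_subset (M.isFlat_cl B) h

theorem cl_cl_union (hA : A ⊆ M.ground) (hB : B ⊆ M.ground) :
    M.cl (M.cl A ∪ B) = M.cl (A ∪ B) := by
  refine (cl_subset_cl (Finset.union_subset (cl_mono Finset.subset_union_left) ?_)).antisymm
    (cl_mono (Finset.union_subset_union_left (subset_cl hA)))
  exact Finset.subset_union_right.trans (subset_cl (Finset.union_subset hA hB))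

theorem rk_union_add_le (hA : A ⊆ B) (hB : B ⊆ M.ground) (hX : X ⊆ M.ground) :
    M.rk (B ∪ X) + M.rk A ≤ M.rk (A ∪ X) + M.rk B := by
  have h := M.rk_submod (A ∪ X) B (Finset.union_subset (hA.trans hB) hX) hB
  have h1 : A ∪ X ∪ B = B ∪ X := by
    rw [Finset.union_right_comm, Finset.union_eq_right.2 hA]
  have h2 := M.rk_mono A ((A ∪ X) ∩ B) (Finset.subset_inter Finset.subset_union_left hA)
    (Finset.inter_subset_right.trans hB)
  rw [h1] at h
  omega

theorem IsFlat.rk_lt (hF : M.IsFlat F) (h : F ⊂ B) (hB : B ⊆ M.ground) : M.rk F < M.rk B := by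
  obtain ⟨e, he, heF⟩ := Finset.exists_of_ssubset h
  exact (hF.2 e (Finset.mem_sdiff.2 ⟨hB he, heF⟩)).trans_le
    (M.rk_mono _ _ (Finset.insert_subset he h.subset) hB)

/-- A largest superset of `A` of the same rank is a flat, and it contains the closure. -/
theorem rk_cl (hA : A ⊆ M.ground) : M.rk (M.cl A) = M.rk A := by
  obtain ⟨B, hB, hmax⟩ := (M.ground.powerset.filter fun B => A ⊆ B ∧ M.rk B = M.rk A).exists_max_image
    Finset.card ⟨A, by simpa using hA⟩
  simp only [Finset.mem_filter, Finset.mem_powerset] at hB hmax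
  have hflat : M.IsFlat B := by
    refine ⟨hB.1, fun e he => ?_⟩
    rw [Finset.mem_sdiff] at he
    have hsub := Finset.insert_subset he.1 hB.1
    refine lt_of_le_of_ne (M.rk_mono _ _ (Finset.subset_insert _ _) hsub) fun h => ?_
    have := hmax (insert e B) ⟨hsub, hB.2.1.trans (Finset.subset_insert _ _), h ▸ hB.2.2⟩
    rw [Finset.card_insert_of_notMem he.2] at this
    omega
  exact le_antisymm ((M.rk_mono _ _ (cl_subset hflat hB.2.1) hB.1).trans hB.2.2.le)
    (M.rk_mono _ _ (subset_cl hA) M.cl_subset_ground)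

theorem IsFlat.inter (hA : M.IsFlat A) (hB : M.IsFlat B) : M.IsFlat (A ∩ B) := by
  have : M.cl (A ∩ B) = A ∩ B :=
    (Finset.subset_inter (cl_subset hA Finset.inter_subset_left)
      (cl_subset hB Finset.inter_subset_right)).antisymm
      (subset_cl (Finset.inter_subset_left.trans hA.1))
  exact this ▸ M.isFlat_cl _

theorem isFlat_ground : M.IsFlat M.ground := ⟨subset_rfl, by simp⟩

theorem Loopless.rk_pos (hM : M.Loopless) (hA : A.Nonempty) (h : A ⊆ M.ground) : 0 < M.rk A := by
  have := IsFlat.rk_lt hM (Finset.empty_ssubset.2 hA) h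
  rwa [M.rk_empty] at this

theorem rk_biUnion_le {ι : Type*} [DecidableEq ι] (s : Finset ι) (A : ι → Finset α)
    (hA : ∀ i ∈ s, A i ⊆ M.ground) : M.rk (s.biUnion A) ≤ ∑ i ∈ s, M.rk (A i) := by
  induction s using Finset.induction_on with
  | empty => simp [M.rk_empty]
  | insert i s hi ih =>
    rw [Finset.biUnion_insert, Finset.sum_insert hi]
    have h1 := ih fun j hj => hA j (Finset.mem_insert_of_mem hj)
    have h2 := M.rk_submod (A i) (s.biUnion A) (hA i (Finset.mem_insert_self _ _))
      (Finset.biUnion_subset.2 fun j hj => hA j (Finset.mem_insert_of_mem hj))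
    omega

/-- The sets `A i` are enlarged to `B i` one at a time, each at a cost bounded by submodularity; `X`
carries the sets already enlarged through the induction. -/
theorem rk_biUnion_union_add_le {ι : Type*} [DecidableEq ι] (s : Finset ι) (A B : ι → Finset α)
    (hB : ∀ i ∈ s, B i ⊆ M.ground) (hA : ∀ i ∈ s, A i ⊆ B i) : ∀ X ⊆ M.ground,
    M.rk (s.biUnion B ∪ X) + ∑ i ∈ s, M.rk (A i) ≤
      M.rk (s.biUnion A ∪ X) + ∑ i ∈ s, M.rk (B i) := by
  induction s using Finset.induction_on with
  | empty => simp
  | insert i s hi ih =>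
    intro X hX
    have hBi := hB i (Finset.mem_insert_self _ _)
    have hAi := hA i (Finset.mem_insert_self _ _)
    have hB' : ∀ j ∈ s, B j ⊆ M.ground := fun j hj => hB j (Finset.mem_insert_of_mem hj)
    have hA' : ∀ j ∈ s, A j ⊆ B j := fun j hj => hA j (Finset.mem_insert_of_mem hj)
    rw [Finset.biUnion_insert, Finset.biUnion_insert, Finset.sum_insert hi, Finset.sum_insert hi]
    have h1 := ih hB' hA' (B i ∪ X) (Finset.union_subset hBi hX)
    have h2 := rk_union_add_le (M := M) hAi hBi (X := s.biUnion A ∪ X) (Finset.union_subset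
      (Finset.biUnion_subset.2 fun j hj => (hA' j hj).trans (hB' j hj)) hX)
    have e1 : s.biUnion B ∪ (B i ∪ X) = B i ∪ s.biUnion B ∪ X := by
      rw [← Finset.union_assoc, Finset.union_comm (s.biUnion B)]
    have e2 : s.biUnion A ∪ (B i ∪ X) = B i ∪ (s.biUnion A ∪ X) := Finset.union_left_comm _ _ _
    rw [e1, e2] at h1
    rw [Finset.union_assoc (A i)]
    omega

/-- Rank additivity passes from a family of sets to any family of subsets. -/
theorem rk_biUnion_eq_of_subset {ι : Type*} [DecidableEq ι] {s : Finset ι} {A B : ι → Finset α}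
    (hB : ∀ i ∈ s, B i ⊆ M.ground) (hA : ∀ i ∈ s, A i ⊆ B i)
    (h : M.rk (s.biUnion B) = ∑ i ∈ s, M.rk (B i)) :
    M.rk (s.biUnion A) = ∑ i ∈ s, M.rk (A i) := by
  have h1 := rk_biUnion_union_add_le s A B hB hA ∅ (Finset.empty_subset _)
  have h2 := rk_biUnion_le s A fun i hi => (hA i hi).trans (hB i hi)
  simp only [Finset.union_empty] at h1
  omega

end Closure

/-! ### Flats and closures in restrictions and contractions -/

section Minors

variable {α : Type*} [DecidableEq α] {M : Polymatroid α} {A X : Finset α}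

theorem isFlat_restrict {F : M.Flat} : (M.restrict F).IsFlat X ↔ M.IsFlat X ∧ X ⊆ F.1 := by
  constructor
  · rintro ⟨h1, h2⟩
    refine ⟨⟨h1.trans F.2.1, fun e he => ?_⟩, h1⟩
    rw [Finset.mem_sdiff] at he
    by_cases heF : e ∈ F.1
    · exact h2 e (Finset.mem_sdiff.2 ⟨heF, he.2⟩)
    · have h3 := F.2.2 e (Finset.mem_sdiff.2 ⟨he.1, heF⟩)
      have h4 := rk_union_add_le (M := M) (A := X) (X := {e}) (B := F.1) h1 F.2.1 (by simpa using he.1)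
      rw [Finset.union_comm, Finset.union_comm X, ← Finset.insert_eq, ← Finset.insert_eq] at h4
      omega
  · rintro ⟨h1, h2⟩
    exact ⟨h2, fun e he => h1.2 e (Finset.sdiff_subset_sdiff F.2.1 subset_rfl he)⟩

theorem cl_restrict {F : M.Flat} (hA : A ⊆ F.1) : (M.restrict F).cl A = M.cl A := by
  have h := isFlat_restrict.1 ((M.restrict F).isFlat_cl A)
  refine Finset.Subset.antisymm ?_ (cl_subset h.1 (subset_cl (M := M.restrict F) hA))
  exact cl_subset (isFlat_restrict.2 ⟨M.isFlat_cl A, cl_subset F.2 hA⟩)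
    (subset_cl (hA.trans F.2.1))

theorem Loopless.restrict (hM : M.Loopless) (F : M.Flat) : (M.restrict F).Loopless :=
  isFlat_restrict.2 ⟨hM, Finset.empty_subset _⟩

theorem isFlat_contract {F : M.Flat} :
    (M.contract F).IsFlat X ↔ Disjoint X F.1 ∧ M.IsFlat (X ∪ F.1) := by
  have key : X ⊆ M.ground → ∀ e ∈ M.ground, ((M.contract F).rk X < (M.contract F).rk (insert e X) ↔
      M.rk (X ∪ F.1) < M.rk (insert e (X ∪ F.1))) := by
    intro hX e he
    have h1 := M.rk_mono F.1 (X ∪ F.1) Finset.subset_union_right (Finset.union_subset hX F.2.1)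
    change M.rk (X ∪ F.1) - M.rk F.1 < M.rk (insert e X ∪ F.1) - M.rk F.1 ↔ _
    rw [Finset.insert_union]
    omega
  constructor
  · rintro ⟨h1, h2⟩
    have hX : X ⊆ M.ground := h1.trans Finset.sdiff_subset
    refine ⟨Finset.disjoint_left.2 fun e he => (Finset.mem_sdiff.1 (h1 he)).2,
      Finset.union_subset hX F.2.1, fun e he => ?_⟩
    simp only [Finset.mem_sdiff, Finset.mem_union, not_or] at he
    exact (key hX e he.1).1 (h2 e (Finset.mem_sdiff.2 ⟨Finset.mem_sdiff.2 ⟨he.1, he.2.2⟩, he.2.1⟩))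
  · rintro ⟨h1, h2⟩
    have hX : X ⊆ M.ground := Finset.subset_union_left.trans h2.1
    refine ⟨fun e he => Finset.mem_sdiff.2 ⟨hX he, Finset.disjoint_left.1 h1 he⟩, fun e he => ?_⟩
    obtain ⟨he1, he2⟩ := Finset.mem_sdiff.1 he
    obtain ⟨he1, he3⟩ := Finset.mem_sdiff.1 he1
    exact (key hX e he1).2 (h2.2 e (by simp [he1, he2, he3]))

theorem isFlat_contract_sdiff {F : M.Flat} (hX : M.IsFlat X) (h : F.1 ⊆ X) :
    (M.contract F).IsFlat (X \ F.1) :=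
  isFlat_contract.2 ⟨Finset.sdiff_disjoint, by rwa [Finset.sdiff_union_of_subset h]⟩

theorem cl_contract {F : M.Flat} (hA : A ⊆ M.ground) :
    (M.contract F).cl (A \ F.1) = M.cl (A ∪ F.1) \ F.1 := by
  have h := isFlat_contract.1 ((M.contract F).isFlat_cl (A \ F.1))
  have hAF := Finset.union_subset hA F.2.1
  refine Finset.Subset.antisymm ?_ ?_
  · refine cl_subset (isFlat_contract_sdiff (M.isFlat_cl _)
      (Finset.subset_union_right.trans (subset_cl hAF))) ?_
    exact Finset.sdiff_subset_sdiff (Finset.subset_union_left.trans (subset_cl hAF)) subset_rfl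
  · suffices hsub : M.cl (A ∪ F.1) ⊆ (M.contract F).cl (A \ F.1) ∪ F.1 from fun x hx =>
      (Finset.mem_union.1 (hsub (Finset.mem_sdiff.1 hx).1)).resolve_right (Finset.mem_sdiff.1 hx).2
    refine cl_subset h.2 ?_
    have := subset_cl (M := M.contract F) (A := A \ F.1)
      (Finset.sdiff_subset_sdiff hA subset_rfl)
    rw [← Finset.sdiff_union_self_eq_union]
    exact Finset.union_subset_union_left this

theorem contract_rk_sdiff {F : M.Flat} (h : F.1 ⊆ A) :
    (M.contract F).rk (A \ F.1) = M.rk A - M.rk F.1 := by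
  change M.rk (A \ F.1 ∪ F.1) - M.rk F.1 = _
  rw [Finset.sdiff_union_of_subset h]

theorem loopless_contract (F : M.Flat) : (M.contract F).Loopless :=
  isFlat_contract.2 ⟨Finset.disjoint_empty_left _, by simpa using F.2⟩

end Minors

end Polymatroid

/-! ### Building sets as product families, and their minors -/

namespace Polymatroid

variable {α : Type*} [DecidableEq α] {M : Polymatroid α} {𝒢 : Finset (Finset α)}
  {F G H K X : Finset α}

theorem mem_factors_restrictFamily : G ∈ factors (restrictFamily 𝒢 F) ↔
    (G ∈ 𝒢 ∧ G ⊆ F) ∧ ∀ H ∈ 𝒢, H ⊆ F → G ⊆ H → H = G := by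
  simp [factors, restrictFamily]

theorem exists_mem_factors_superset (hG : G ∈ 𝒢) : ∃ H ∈ factors 𝒢, G ⊆ H := by
  obtain ⟨H, hGH, hH⟩ := 𝒢.exists_le_maximal hG
  exact ⟨H, Finset.mem_filter.2 ⟨hH.1, fun K hK h => (hH.2 hK h).antisymm h⟩, hGH⟩

theorem exists_mem_factors_restrictFamily (hG : G ∈ 𝒢) (h : G ⊆ F) :
    ∃ H ∈ factors (restrictFamily 𝒢 F), G ⊆ H :=
  exists_mem_factors_superset (Finset.mem_filter.2 ⟨hG, h⟩)

/-- The maximal elements of a family are determined by being a dominating antichain. -/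
theorem factors_eq_of_antichain {P : Finset (Finset α)} (hP : P ⊆ 𝒢)
    (hdom : ∀ G ∈ 𝒢, ∃ H ∈ P, G ⊆ H) (hanti : ∀ G ∈ P, ∀ H ∈ P, G ⊆ H → H = G) :
    factors 𝒢 = P := by
  ext G
  rw [factors, Finset.mem_filter]
  constructor
  · rintro ⟨hG, hmax⟩
    obtain ⟨H, hH, hGH⟩ := hdom G hG
    exact hmax H (hP hH) hGH ▸ hH
  · intro hG
    refine ⟨hP hG, fun H hH hGH => ?_⟩
    obtain ⟨K, hK, hHK⟩ := hdom H hH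
    have := hanti G hG K hK (hGH.trans hHK)
    exact (this ▸ hHK).antisymm hGH

variable (M 𝒢) in
/-- Building sets, described through ranks and closures: the lattice of flats below `F` is the
product of the lattices below the factors of `F`. -/
structure IsProductFamily : Prop where
  isFlat : ∀ G ∈ 𝒢, M.IsFlat G
  nonempty : ∀ G ∈ 𝒢, G.Nonempty
  rk_eq : ∀ F, M.IsFlat F → M.rk F = ∑ G ∈ factors (restrictFamily 𝒢 F), M.rk G
  cl_inter : ∀ F, M.IsFlat F → ∀ X, M.IsFlat X → X ⊆ F →
    M.cl ((factors (restrictFamily 𝒢 F)).biUnion fun G => X ∩ G) = X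

/-- Only surjectivity of the join map is needed: the coordinates of a preimage of `X` lie in the
sets `X ∩ G` and already have closure `X`. Uniqueness of coordinates is recovered from rank
additivity in `cl_biUnion_inter`. -/
theorem IsBuildingSet.isProductFamily (h : M.IsBuildingSet 𝒢) : M.IsProductFamily 𝒢 where
  isFlat := h.isFlat
  nonempty := h.nonempty
  rk_eq := h.rk_eq
  cl_inter F hF X hX hXF := by
    obtain ⟨φ, hφ⟩ := h.join_iso F hF
    set x := φ.symm ⟨X, hX, hXF⟩ with hx
    have hcl : M.cl (Finset.univ.biUnion fun G => (x G).1) = X := by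
      rw [← hφ, hx, OrderIso.apply_symm_apply]
    refine (cl_subset hX (Finset.biUnion_subset.2 fun _ _ => Finset.inter_subset_left)).antisymm ?_
    rw [← hcl]
    refine cl_mono (Finset.biUnion_subset.2 fun G _ => ?_)
    refine Finset.Subset.trans ?_ (Finset.subset_biUnion_of_mem _ G.2)
    refine Finset.subset_inter ?_ (x G).2.2
    refine (Finset.subset_biUnion_of_mem (fun G => (x G).1) (Finset.mem_univ G)).trans
      (subset_cl (Finset.biUnion_subset.2 fun G _ => (x G).2.1.1))

namespace IsProductFamily

theorem factor_subset (hG : G ∈ factors (restrictFamily 𝒢 F)) : G ⊆ F :=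
  (mem_factors_restrictFamily.1 hG).1.2

theorem factor_isFlat (h : M.IsProductFamily 𝒢) (hG : G ∈ factors (restrictFamily 𝒢 F)) :
    M.IsFlat G := h.isFlat G (mem_factors_restrictFamily.1 hG).1.1

theorem rk_biUnion (h : M.IsProductFamily 𝒢) (hF : M.IsFlat F) {A : Finset α → Finset α}
    (hA : ∀ G ∈ factors (restrictFamily 𝒢 F), A G ⊆ G) :
    M.rk ((factors (restrictFamily 𝒢 F)).biUnion A) =
      ∑ G ∈ factors (restrictFamily 𝒢 F), M.rk (A G) := by
  refine rk_biUnion_eq_of_subset (B := id) (fun G hG => (factor_subset hG).trans hF.1) hA ?_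
  have h1 := h.cl_inter F hF F hF subset_rfl
  have h2 : ((factors (restrictFamily 𝒢 F)).biUnion fun G => F ∩ G)
      = (factors (restrictFamily 𝒢 F)).biUnion id :=
    Finset.biUnion_congr rfl fun G hG => Finset.inter_eq_right.2 (factor_subset hG)
  rw [h2] at h1
  have h3 : (factors (restrictFamily 𝒢 F)).biUnion id ⊆ M.ground :=
    Finset.biUnion_subset.2 fun G hG => (factor_subset hG).trans hF.1
  rw [← rk_cl h3, h1, h.rk_eq F hF]
  rfl

/-- By rank additivity, a point common to two factors would satisfy `2 * rk {a} ≤ rk {a}`. -/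
theorem disjoint (h : M.IsProductFamily 𝒢) (hM : M.Loopless) (hF : M.IsFlat F)
    (hG : G ∈ factors (restrictFamily 𝒢 F)) (hH : H ∈ factors (restrictFamily 𝒢 F))
    (hne : G ≠ H) : Disjoint G H := by
  rw [Finset.disjoint_left]
  intro a haG haH
  have h1 := h.rk_biUnion hF (A := fun K => if K = G ∨ K = H then {a} else ∅) fun K _ => by
    split_ifs with hK
    · rcases hK with rfl | rfl <;> simpa
    · exact Finset.empty_subset _
  have ha : {a} ⊆ M.ground := by simpa using hF.1 (factor_subset hG haG)
  have h2 : ((factors (restrictFamily 𝒢 F)).biUnion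
      fun K => if K = G ∨ K = H then ({a} : Finset α) else ∅) ⊆ {a} :=
    Finset.biUnion_subset.2 fun K _ => by split_ifs <;> simp
  have h3 := M.rk_mono _ _ h2 ha
  have h4 : ∑ K ∈ {G, H}, M.rk (if K = G ∨ K = H then ({a} : Finset α) else ∅) ≤
      ∑ K ∈ factors (restrictFamily 𝒢 F), M.rk (if K = G ∨ K = H then {a} else ∅) :=
    Finset.sum_le_sum_of_subset (by simp [Finset.insert_subset_iff, hG, hH])
  rw [Finset.sum_pair hne] at h4
  simp only [true_or, or_true, if_true] at h4
  have := hM.rk_pos (Finset.singleton_nonempty a) ha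
  omega

/-- If the closure met `G` in more than `A G`, replacing `A G` by that intersection would increase
the sum of the ranks without increasing the rank of the union, against additivity. -/
theorem cl_biUnion_inter (h : M.IsProductFamily 𝒢) (hF : M.IsFlat F)
    {A : Finset α → Finset α} (hA : ∀ G ∈ factors (restrictFamily 𝒢 F), A G ⊆ G)
    (hAf : ∀ G ∈ factors (restrictFamily 𝒢 F), M.IsFlat (A G))
    (hG : G ∈ factors (restrictFamily 𝒢 F)) :
    M.cl ((factors (restrictFamily 𝒢 F)).biUnion A) ∩ G = A G := by
  set Γ := factors (restrictFamily 𝒢 F) with hΓ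
  have hsub : Γ.biUnion A ⊆ M.ground :=
    Finset.biUnion_subset.2 fun H hH => (hAf H hH).1
  refine Finset.Subset.antisymm ?_ (Finset.subset_inter
    ((Finset.subset_biUnion_of_mem A hG).trans (subset_cl hsub)) (hA G hG))
  set B := M.cl (Γ.biUnion A) ∩ G with hB
  by_contra hcon
  have hAB : A G ⊆ B := Finset.subset_inter
    ((Finset.subset_biUnion_of_mem A hG).trans (subset_cl hsub)) (hA G hG)
  have hlt := (hAf G hG).rk_lt (hAB.ssubset_of_ne fun heq => hcon heq.ge)
    (Finset.inter_subset_left.trans M.cl_subset_ground)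
  have h1 := h.rk_biUnion hF hA
  have h2 := h.rk_biUnion hF (A := Function.update A G B) fun H hH => by
    by_cases hHG : H = G
    · subst hHG
      simp [hB]
    · simpa [hHG] using hA H hH
  have h3 : M.rk (Γ.biUnion (Function.update A G B)) ≤ M.rk (Γ.biUnion A) := by
    rw [← rk_cl hsub]
    refine M.rk_mono _ _ (Finset.biUnion_subset.2 fun H hH => ?_) M.cl_subset_ground
    by_cases hHG : H = G
    · subst hHG
      simp [hB]
    · rw [Function.update_of_ne hHG]
      exact (Finset.subset_biUnion_of_mem A hH).trans (subset_cl hsub)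
  have h4 : ∑ H ∈ Γ, M.rk (A H) < ∑ H ∈ Γ, M.rk (Function.update A G B H) := by
    refine Finset.sum_lt_sum (fun H _ => ?_) ⟨G, hG, by simpa using hlt⟩
    by_cases hHG : H = G
    · subst hHG
      simpa using hlt.le
    · simp [hHG]
  rw [← hΓ] at h1 h2
  omega

/-- The factors of the join that contain `G` and `H` share a point, so they coincide, and the common
factor is the whole join. -/
theorem cl_union_mem (h : M.IsProductFamily 𝒢) (hM : M.Loopless) (hG : G ∈ 𝒢) (hH : H ∈ 𝒢)
    (hne : (G ∩ H).Nonempty) : M.cl (G ∪ H) ∈ 𝒢 := by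
  have hF := M.isFlat_cl (G ∪ H)
  have hsub := subset_cl (M := M) (Finset.union_subset (h.isFlat G hG).1 (h.isFlat H hH).1)
  obtain ⟨G', hG', hGG⟩ := exists_mem_factors_restrictFamily hG (Finset.subset_union_left.trans hsub)
  obtain ⟨H', hH', hHH⟩ := exists_mem_factors_restrictFamily hH
    (Finset.subset_union_right.trans hsub)
  obtain ⟨a, ha⟩ := hne
  rw [Finset.mem_inter] at ha
  have heq : G' = H' := by
    by_contra hcon
    exact Finset.disjoint_left.1 (h.disjoint hM hF hG' hH' hcon) (hGG ha.1) (hHH ha.2)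
  subst heq
  have : M.cl (G ∪ H) = G' := (cl_subset (h.factor_isFlat hG')
    (Finset.union_subset hGG hHH)).antisymm (factor_subset hG')
  exact this ▸ (mem_factors_restrictFamily.1 hG').1.1

theorem factors_restrict_restrict {F : M.Flat} (hX : X ⊆ F.1) :
    restrictFamily (restrictFamily 𝒢 F.1) X = restrictFamily 𝒢 X := by
  ext G
  simp only [restrictFamily, Finset.mem_filter]
  exact ⟨fun h => ⟨h.1.1, h.2⟩, fun h => ⟨⟨h.1, h.2.trans hX⟩, h.2⟩⟩

theorem restrict (h : M.IsProductFamily 𝒢) (F : M.Flat) :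
    (M.restrict F).IsProductFamily (restrictFamily 𝒢 F.1) where
  isFlat G hG := isFlat_restrict.2
    ⟨h.isFlat G (Finset.mem_filter.1 hG).1, (Finset.mem_filter.1 hG).2⟩
  nonempty G hG := h.nonempty G (Finset.mem_filter.1 hG).1
  rk_eq X hX := by
    rw [isFlat_restrict] at hX
    rw [factors_restrict_restrict hX.2]
    exact h.rk_eq X hX.1
  cl_inter K hK X hX hXK := by
    rw [isFlat_restrict] at hK hX
    rw [factors_restrict_restrict hK.2, cl_restrict]
    · exact h.cl_inter K hK.1 X hX.1 hXK
    · exact Finset.biUnion_subset.2 fun G _ => Finset.inter_subset_left.trans hX.2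

/-- In the coordinates given by the factors of `K`, joining `F` with the factor `G` replaces the
coordinate at `G` by `G` and leaves the others alone. -/
theorem cl_union_inter_eq (h : M.IsProductFamily 𝒢) (hK : M.IsFlat K) (hF : M.IsFlat F)
    (hFK : F ⊆ K) (hG : G ∈ factors (restrictFamily 𝒢 K)) :
    (∀ H ∈ factors (restrictFamily 𝒢 K), H ≠ G → M.cl (G ∪ F) ∩ H = F ∩ H) ∧
      M.rk (G ∪ F) + M.rk (F ∩ G) = M.rk F + M.rk G := by
  set Γ := factors (restrictFamily 𝒢 K) with hΓ
  set A : Finset α → Finset α := Function.update (fun H => F ∩ H) G G with hA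
  have hAsub : ∀ H ∈ Γ, A H ⊆ H := fun H _ => by
    by_cases hHG : H = G
    · simp [hA, hHG]
    · simp [hA, hHG]
  have hAf : ∀ H ∈ Γ, M.IsFlat (A H) := fun H hH => by
    by_cases hHG : H = G
    · simpa [hA, hHG] using h.factor_isFlat hG
    · simpa [hA, hHG] using hF.inter (h.factor_isFlat hH)
  have hAg : Γ.biUnion A ⊆ M.ground := Finset.biUnion_subset.2 fun H hH => (hAf H hH).1
  have hcl : M.cl (Γ.biUnion A) = M.cl (G ∪ F) := by
    refine Finset.Subset.antisymm (cl_mono (Finset.biUnion_subset.2 fun H hH => ?_))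
      (cl_subset_cl (Finset.union_subset ?_ ?_))
    · by_cases hHG : H = G
      · simp [hA, hHG]
      · simp only [hA, Function.update_of_ne hHG]
        exact Finset.inter_subset_left.trans Finset.subset_union_right
    · have := Finset.subset_biUnion_of_mem A hG
      simp only [hA, Function.update_self] at this
      exact this.trans (subset_cl hAg)
    · rw [← h.cl_inter K hK F hF hFK]
      refine cl_mono (Finset.biUnion_subset.2 fun H hH => ?_)
      refine Finset.Subset.trans ?_ (Finset.subset_biUnion_of_mem A hH)
      by_cases hHG : H = G
      · subst hHG
        simp [hA]
      · simp [hA, hHG]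
  constructor
  · intro H hH hHG
    rw [← hcl, h.cl_biUnion_inter hK hAsub hAf hH]
    simp [hA, hHG]
  · have h1 := h.rk_biUnion hK hAsub
    rw [← rk_cl hAg, hcl, rk_cl (Finset.union_subset (h.factor_isFlat hG).1 hF.1)] at h1
    have h2 := h.rk_biUnion hK (A := fun H => F ∩ H) fun H _ => Finset.inter_subset_right
    rw [← rk_cl (Finset.biUnion_subset.2 fun H _ => Finset.inter_subset_left.trans hF.1),
      h.cl_inter K hK F hF hFK] at h2
    rw [h1, h2, ← Finset.add_sum_erase _ _ hG, ← Finset.add_sum_erase (a := G) _ _ hG]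
    have h3 : ∑ H ∈ Γ.erase G, M.rk (A H) = ∑ H ∈ Γ.erase G, M.rk (F ∩ H) :=
      Finset.sum_congr rfl fun H hH => by simp [hA, (Finset.mem_erase.1 hH).1]
    rw [h3]
    simp only [hA, Function.update_self]
    ring

theorem eq_of_subset_cl_union (h : M.IsProductFamily 𝒢) (hK : M.IsFlat K) (hF : M.IsFlat F)
    (hFK : F ⊆ K) (hG : G ∈ factors (restrictFamily 𝒢 K)) (hH : H ∈ factors (restrictFamily 𝒢 K))
    (hGF : ¬ G ⊆ F) (hsub : G ⊆ M.cl (H ∪ F)) : H = G := by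
  by_contra hcon
  have := (h.cl_union_inter_eq hK hF hFK hH).1 G hG (Ne.symm hcon)
  rw [Finset.inter_eq_right.2 hsub] at this
  exact hGF (this ▸ Finset.inter_subset_left)

theorem subset_of_sdiff_subset_sdiff {F : M.Flat} (hG : M.IsFlat G)
    (hsub : M.cl (G ∪ F.1) \ F.1 ⊆ K \ F.1) (hFK : F.1 ⊆ K) : G ⊆ K := fun x hx => by
  by_cases hxF : x ∈ F.1
  · exact hFK hxF
  · exact (Finset.mem_sdiff.1 (hsub (Finset.mem_sdiff.2 ⟨subset_cl
      (Finset.union_subset hG.1 F.2.1) (Finset.mem_union_left _ hx), hxF⟩))).1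

/-- Joining with `F` preserves domination, and by `eq_of_subset_cl_union` the images of the factors
not contained in `F` remain an antichain. -/
theorem factors_contractFamily (h : M.IsProductFamily 𝒢) (F : M.Flat) (hK : M.IsFlat K)
    (hFK : F.1 ⊆ K) : factors (restrictFamily (M.contractFamily 𝒢 F.1) (K \ F.1)) =
      ((factors (restrictFamily 𝒢 K)).filter fun G => ¬ G ⊆ F.1).image
        fun G => M.cl (G ∪ F.1) \ F.1 := by
  apply factors_eq_of_antichain
  · intro G' hG'
    obtain ⟨G, hG, rfl⟩ := Finset.mem_image.1 hG'
    obtain ⟨hG, hGF⟩ := Finset.mem_filter.1 hG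
    refine Finset.mem_filter.2 ⟨Finset.mem_image.2 ⟨G, Finset.mem_filter.2
      ⟨(mem_factors_restrictFamily.1 hG).1.1, hGF⟩, rfl⟩, ?_⟩
    exact Finset.sdiff_subset_sdiff
      (cl_subset hK (Finset.union_subset (factor_subset hG) hFK)) subset_rfl
  · intro G' hG'
    obtain ⟨hG', hsub⟩ := Finset.mem_filter.1 hG'
    obtain ⟨G, hG, rfl⟩ := Finset.mem_image.1 hG'
    obtain ⟨hG, hGF⟩ := Finset.mem_filter.1 hG
    obtain ⟨H, hH, hGH⟩ := exists_mem_factors_restrictFamily hG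
      (subset_of_sdiff_subset_sdiff (h.isFlat G hG) hsub hFK)
    exact ⟨_, Finset.mem_image_of_mem _ (Finset.mem_filter.2 ⟨hH, fun hHF => hGF (hGH.trans hHF)⟩),
      Finset.sdiff_subset_sdiff (cl_mono (Finset.union_subset_union_left hGH)) subset_rfl⟩
  · intro G' hG' H' hH' hsub
    obtain ⟨G, hG, rfl⟩ := Finset.mem_image.1 hG'
    obtain ⟨hG, hGF⟩ := Finset.mem_filter.1 hG
    obtain ⟨H, hH, rfl⟩ := Finset.mem_image.1 hH'
    obtain ⟨hH, -⟩ := Finset.mem_filter.1 hH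
    rw [h.eq_of_subset_cl_union hK F.2 hFK hG hH hGF (subset_of_sdiff_subset_sdiff
      (h.factor_isFlat hG) hsub (Finset.subset_union_right.trans
        (subset_cl (Finset.union_subset (h.factor_isFlat hH).1 F.2.1))))]

theorem contract_injOn (h : M.IsProductFamily 𝒢) (F : M.Flat) (hK : M.IsFlat K)
    (hFK : F.1 ⊆ K) : Set.InjOn (fun G => M.cl (G ∪ F.1) \ F.1)
      (((factors (restrictFamily 𝒢 K)).filter fun G => ¬ G ⊆ F.1 : Finset _) : Set (Finset α)) := by
  intro G hG H hH heq
  obtain ⟨hG, hGF⟩ := Finset.mem_filter.1 (Finset.mem_coe.1 hG)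
  obtain ⟨hH, -⟩ := Finset.mem_filter.1 (Finset.mem_coe.1 hH)
  exact (h.eq_of_subset_cl_union hK F.2 hFK hG hH hGF (subset_of_sdiff_subset_sdiff
      (h.factor_isFlat hG) heq.le (Finset.subset_union_right.trans
        (subset_cl (Finset.union_subset (h.factor_isFlat hH).1 F.2.1))))).symm

theorem contract (h : M.IsProductFamily 𝒢) (F : M.Flat) :
    (M.contract F).IsProductFamily (M.contractFamily 𝒢 F.1) where
  isFlat G' hG' := by
    obtain ⟨G, hG, rfl⟩ := Finset.mem_image.1 hG'
    obtain ⟨hG, hGF⟩ := Finset.mem_filter.1 hG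
    exact isFlat_contract_sdiff (M.isFlat_cl _) (Finset.subset_union_right.trans
      (subset_cl (Finset.union_subset (h.isFlat G hG).1 F.2.1)))
  nonempty G' hG' := by
    obtain ⟨G, hG, rfl⟩ := Finset.mem_image.1 hG'
    obtain ⟨hG, hGF⟩ := Finset.mem_filter.1 hG
    obtain ⟨a, ha, haF⟩ := Finset.not_subset.1 hGF
    exact ⟨a, Finset.mem_sdiff.2 ⟨subset_cl (Finset.union_subset (h.isFlat G hG).1 F.2.1)
      (Finset.mem_union_left _ ha), haF⟩⟩
  rk_eq K' hK' := by
    obtain ⟨hdisj, hK⟩ := isFlat_contract.1 hK'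
    have hFK : F.1 ⊆ K' ∪ F.1 := Finset.subset_union_right
    have hKe : K' = (K' ∪ F.1) \ F.1 := by
      rw [Finset.union_sdiff_right, Finset.sdiff_eq_self_of_disjoint hdisj]
    generalize K' ∪ F.1 = K at hK hFK hKe
    rw [hKe, h.factors_contractFamily F hK hFK, Finset.sum_image (h.contract_injOn F hK hFK),
      contract_rk_sdiff hFK, h.rk_eq K hK]
    have h2 := h.rk_biUnion hK (A := fun H => F.1 ∩ H) fun H _ => Finset.inter_subset_right
    rw [← rk_cl (Finset.biUnion_subset.2 fun H _ => Finset.inter_subset_left.trans F.2.1),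
      h.cl_inter K hK F.1 F.2 hFK] at h2
    -- The rank of `K \ F` in the contraction is the sum over the factors of `rk G - rk (F ∩ G)`.
    -- Terms with `G ⊆ F` vanish; each other term is the rank of the image of `G`.
    rw [h2, ← Finset.sum_tsub_distrib, ← Finset.sum_filter_add_sum_filter_not _ fun G => ¬ G ⊆ F.1,
      Finset.sum_eq_zero (s := Finset.filter (fun G => ¬ ¬ G ⊆ F.1) _), add_zero]
    · refine Finset.sum_congr rfl fun G hG => ?_
      obtain ⟨hG, -⟩ := Finset.mem_filter.1 hG
      have hu := Finset.union_subset (h.factor_isFlat hG).1 F.2.1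
      rw [contract_rk_sdiff (Finset.subset_union_right.trans (subset_cl hu)), rk_cl hu]
      have := (h.cl_union_inter_eq hK F.2 hFK hG).2
      omega
    · intro G hG
      rw [Finset.inter_eq_right.2 (not_not.1 (Finset.mem_filter.1 hG).2), Nat.sub_self]
    · intro G hG
      exact M.rk_mono _ _ Finset.inter_subset_right (h.factor_isFlat hG).1
  cl_inter K' hK' X' hX' hXK := by
    obtain ⟨hdisj, hK⟩ := isFlat_contract.1 hK'
    obtain ⟨hdisjX, hX⟩ := isFlat_contract.1 hX'
    refine (cl_subset hX' (Finset.biUnion_subset.2 fun _ _ =>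
      Finset.inter_subset_left)).antisymm ?_
    have hFK : F.1 ⊆ K' ∪ F.1 := Finset.subset_union_right
    have hKe : K' = (K' ∪ F.1) \ F.1 := by
      rw [Finset.union_sdiff_right, Finset.sdiff_eq_self_of_disjoint hdisj]
    have hXK' : X' ∪ F.1 ⊆ K' ∪ F.1 := Finset.union_subset_union_left hXK
    generalize K' ∪ F.1 = K at hK hFK hKe hXK'
    rw [hKe, h.factors_contractFamily F hK hFK]
    set Z := (((factors (restrictFamily 𝒢 K)).filter fun G => ¬ G ⊆ F.1).image
        fun G => M.cl (G ∪ F.1) \ F.1).biUnion fun G => X' ∩ G with hZ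
    have hZg : Z ⊆ (M.contract F).ground :=
      Finset.biUnion_subset.2 fun _ _ => Finset.inter_subset_left.trans hX'.1
    have hY := (isFlat_contract.1 ((M.contract F).isFlat_cl Z)).2
    have hsub : X' ∪ F.1 ⊆ (M.contract F).cl Z ∪ F.1 := by
      rw [← h.cl_inter K hK _ hX hXK']
      refine cl_subset hY (Finset.biUnion_subset.2 fun G hG x hx => ?_)
      obtain ⟨hxX, hxG⟩ := Finset.mem_inter.1 hx
      rw [Finset.mem_union]
      by_cases hxF : x ∈ F.1
      · exact Or.inr hxF
      · refine Or.inl (subset_cl hZg (Finset.mem_biUnion.2 ⟨_, Finset.mem_image_of_mem _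
          (Finset.mem_filter.2 ⟨hG, fun hGF => hxF (hGF hxG)⟩), ?_⟩))
        exact Finset.mem_inter.2 ⟨(Finset.mem_union.1 hxX).resolve_right hxF,
          Finset.mem_sdiff.2 ⟨subset_cl (Finset.union_subset (h.factor_isFlat hG).1 F.2.1)
            (Finset.mem_union_left _ hxG), hxF⟩⟩
    intro x hx
    exact (Finset.mem_union.1 (hsub (Finset.mem_union_left _ hx))).resolve_right
      (Finset.disjoint_left.1 hdisjX hx)

end IsProductFamily

end Polymatroid

/-! ### The exponents of the Chow relations and the Hilbert series -/

namespace Polymatroid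

variable {α : Type*} [DecidableEq α] {M : Polymatroid α} {𝒢 : Finset (Finset α)}
  {G H K X : Finset α} {S T : Finset (Finset α)}

variable (M) in
/-- The exponent `rk G - rk (sup (S, G))`. -/
def rkDrop (S : Finset (Finset α)) (G : Finset α) : ℕ := M.rk G - M.rk (M.supBelow S G)

theorem supBelow_subset (hX : M.IsFlat X) (h : ∀ K ∈ S, K ⊂ G → K ⊆ X) : M.supBelow S G ⊆ X :=
  cl_subset hX (Finset.biUnion_subset.2 fun K hK =>
    h K (Finset.mem_filter.1 hK).1 (Finset.mem_filter.1 hK).2)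

theorem supBelow_subset_self (hG : M.IsFlat G) : M.supBelow S G ⊆ G :=
  supBelow_subset hG fun _ _ h => h.subset

theorem isFlat_supBelow : M.IsFlat (M.supBelow S G) := M.isFlat_cl _

theorem subset_supBelow (hG : M.IsFlat G) (hK : K ∈ S) (h : K ⊂ G) : K ⊆ M.supBelow S G := by
  refine Finset.Subset.trans ?_ (subset_cl (Finset.biUnion_subset.2 fun L hL =>
    (Finset.mem_filter.1 hL).2.subset.trans hG.1))
  exact Finset.subset_biUnion_of_mem id (Finset.mem_filter.2 ⟨hK, h⟩)

theorem rkDrop_le_rkDrop (h : ∀ K ∈ S, K ⊂ G → K ⊆ M.supBelow T G) :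
    M.rkDrop T G ≤ M.rkDrop S G :=
  Nat.sub_le_sub_left (M.rk_mono _ _ (supBelow_subset isFlat_supBelow h)
    M.cl_subset_ground) _

theorem rkDrop_congr (h : ∀ K, K ⊂ G → (K ∈ S ↔ K ∈ T)) : M.rkDrop S G = M.rkDrop T G := by
  rw [rkDrop, rkDrop, supBelow, supBelow]
  congr 4
  ext K
  simp only [Finset.mem_filter]
  exact ⟨fun hK => ⟨(h K hK.2).1 hK.1, hK.2⟩, fun hK => ⟨(h K hK.2).2 hK.1, hK.2⟩⟩

theorem rkDrop_pos_iff (hG : M.IsFlat G) : 0 < M.rkDrop S G ↔ M.supBelow S G ≠ G := by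
  rw [rkDrop, Nat.sub_pos_iff_lt]
  constructor
  · intro h heq
    rw [heq] at h
    exact lt_irrefl _ h
  · intro h
    exact isFlat_supBelow.rk_lt ((supBelow_subset_self hG).ssubset_of_ne h) hG.1

theorem IsProductFamily.isChowExponent (h : M.IsProductFamily 𝒢) (hM : M.Loopless) :
    IsChowExponent fun (S : Finset {G // G ∈ 𝒢}) (G : {G // G ∈ 𝒢}) =>
      M.rkDrop (S.image Subtype.val) G.1 where
  antitone S T H hST := rkDrop_le_rkDrop fun K hK hKH =>
    subset_supBelow (h.isFlat _ H.2) (Finset.image_subset_image hST hK) hKH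
  insert_of_not_lt S G H hGH := rkDrop_congr fun K hKH => by
    rw [Finset.image_insert, Finset.mem_insert, or_iff_right]
    rintro rfl
    exact hGH hKH
  insert_le_insert S G K H hGK hKH := by
    refine rkDrop_le_rkDrop fun L hL hLH => ?_
    rw [Finset.image_insert] at hL ⊢
    rcases Finset.mem_insert.1 hL with rfl | hL
    · exact (show G.1 ⊆ K.1 from hGK.le).trans
        (subset_supBelow (h.isFlat _ H.2) (Finset.mem_insert_self _ _) hKH)
    · exact subset_supBelow (h.isFlat _ H.2) (Finset.mem_insert_of_mem hL) hLH
  le_add S G H hGH := by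
    have hG := h.isFlat _ G.2
    have hH := h.isFlat _ H.2
    have hGH' : G.1 ⊂ H.1 := hGH
    rw [Finset.image_insert]
    set S' := S.image Subtype.val
    -- Submodularity is applied to `sup (S, H)` and `G`: their join contains `sup (S ∪ {G}, H)`,
    -- their meet contains `sup (S, G)`.
    have h1 : M.supBelow (insert G.1 S') H.1 ⊆ M.cl (M.supBelow S' H.1 ∪ G.1) := by
      have hsub := subset_cl (M := M) (A := M.supBelow S' H.1 ∪ G.1)
        (Finset.union_subset isFlat_supBelow.1 hG.1)
      refine supBelow_subset (M.isFlat_cl _) fun K hK hKH => ?_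
      rcases Finset.mem_insert.1 hK with rfl | hK
      · exact Finset.subset_union_right.trans hsub
      · exact (subset_supBelow hH hK hKH).trans (Finset.subset_union_left.trans hsub)
    have h2 : M.supBelow S' G.1 ⊆ M.supBelow S' H.1 ∩ G.1 :=
      Finset.subset_inter (supBelow_subset isFlat_supBelow fun K hK hKG =>
        subset_supBelow hH hK (hKG.trans hGH')) (supBelow_subset_self hG)
    have h3 := M.rk_submod (M.supBelow S' H.1) G.1 isFlat_supBelow.1 hG.1
    have h4 := M.rk_mono _ _ h1 M.cl_subset_ground
    rw [rk_cl (Finset.union_subset isFlat_supBelow.1 hG.1)] at h4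
    have h5 := M.rk_mono _ _ h2 (Finset.inter_subset_right.trans hG.1)
    have h6 := M.rk_mono _ _ (supBelow_subset_self (S := S') hG) hG.1
    have h7 := M.rk_mono _ _ (supBelow_subset_self (S := S') hH) hH.1
    simp only [rkDrop]
    omega
  exists_join G K H hGK hGH hKH hHK := by
    have hK := h.isFlat _ K.2
    have hH := h.isFlat _ H.2
    have hKHg := Finset.union_subset hK.1 hH.1
    have hsub := subset_cl (M := M) hKHg
    have hJ : M.cl (K.1 ∪ H.1) ∈ 𝒢 := h.cl_union_mem hM K.2 H.2
      ((h.nonempty _ G.2).mono (Finset.subset_inter hGK hGH))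
    have hJf := h.isFlat _ hJ
    have hKJ : K.1 ⊂ M.cl (K.1 ∪ H.1) :=
      (Finset.subset_union_left.trans hsub).ssubset_of_ne fun heq => hHK
        (show H.1 ⊆ K.1 by rw [heq]; exact Finset.subset_union_right.trans hsub)
    have hHJ : H.1 ⊂ M.cl (K.1 ∪ H.1) :=
      (Finset.subset_union_right.trans hsub).ssubset_of_ne fun heq => hKH
        (show K.1 ⊆ H.1 by rw [heq]; exact Finset.subset_union_left.trans hsub)
    refine ⟨⟨_, hJ⟩, fun L => ⟨fun hL => ?_, fun hL => ?_⟩, ?_, fun S => ?_⟩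
    · exact ⟨(Finset.subset_union_left.trans hsub).trans hL,
        (Finset.subset_union_right.trans hsub).trans hL⟩
    · exact cl_subset (h.isFlat _ L.2) (Finset.union_subset hL.1 hL.2)
    · rw [Finset.image_insert, Finset.image_singleton, rkDrop, Nat.sub_eq_zero_iff_le]
      refine M.rk_mono _ _ (cl_subset isFlat_supBelow (Finset.union_subset ?_ ?_))
        M.cl_subset_ground
      · exact subset_supBelow hJf (by simp) hKJ
      · exact subset_supBelow hJf (by simp) hHJ
    · rw [Finset.image_insert, Finset.image_insert]
      set S' := S.image Subtype.val
      have hGH' : G.1 ⊂ H.1 := Finset.ssubset_iff_subset_ne.2 ⟨hGH, fun heq => hHK 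
        (show H.1 ⊆ K.1 from heq ▸ (show G.1 ⊆ K.1 from hGK))⟩
      -- As `K ⊆ Y`, the join `J` has rank at most `rk (Y ∪ H)`, so its drop is at most `rk H - rk
      -- (Y ∩ H)` by submodularity; and `Y ∩ H` contains `sup (S ∪ {G}, H)`.
      set Y := M.supBelow (insert K.1 S') (M.cl (K.1 ∪ H.1)) with hY
      have hYf : M.IsFlat Y := isFlat_supBelow
      have hKY : K.1 ⊆ Y := subset_supBelow hJf (Finset.mem_insert_self _ _) hKJ
      have h1 : M.supBelow (insert G.1 S') H.1 ⊆ Y ∩ H.1 := by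
        refine Finset.subset_inter (supBelow_subset hYf fun L hL hLH => ?_)
          (supBelow_subset_self hH)
        rcases Finset.mem_insert.1 hL with rfl | hL
        · exact Finset.Subset.trans hGK hKY
        · exact subset_supBelow hJf (Finset.mem_insert_of_mem hL) (hLH.trans hHJ)
      have h2 := M.rk_submod Y H.1 hYf.1 hH.1
      have h3 : M.rk (M.cl (K.1 ∪ H.1)) ≤ M.rk (Y ∪ H.1) := by
        rw [rk_cl hKHg]
        exact M.rk_mono _ _ (Finset.union_subset_union_left hKY) (Finset.union_subset hYf.1 hH.1)
      have h4 := M.rk_mono _ _ h1 (Finset.inter_subset_right.trans hH.1)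
      have h5 := M.rk_mono _ _ (supBelow_subset_self (S := insert G.1 S') hH) hH.1
      simp only [rkDrop, ← hY]
      omega

open Classical in
theorem chowIdeal_eq_relIdeal : M.chowIdeal 𝒢 =
    relIdeal ℚ (fun (S : Finset {G // G ∈ 𝒢}) (G : {G // G ∈ 𝒢}) =>
      M.rkDrop (S.image Subtype.val) G.1) Finset.univ ∅ := by
  rw [chowIdeal, relIdeal]
  congr 1
  ext p
  have hup : ∀ G : {G // G ∈ 𝒢},
      ∑ H ∈ Finset.univ.filter (fun H : {G // G ∈ 𝒢} => G.1 ⊆ H.1), MvPolynomial.X H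
        = upSum ℚ G := fun G => Finset.sum_congr (by ext; simp [← Subtype.coe_le_coe]) fun _ _ => rfl
  simp only [Set.mem_ofPred_eq, Finset.subset_univ, Finset.mem_univ, true_and, Finset.union_empty,
    hup, rkDrop]

variable (M 𝒢) in
/-- The sum, over the subsets of `𝒢` whose members are nowhere joins of smaller ones in the subset,
of the products of the truncated geometric series. -/
noncomputable def nestedSeries : PowerSeries ℚ :=
  ∑ T ∈ 𝒢.powerset with ∀ H ∈ 𝒢, 0 < M.rkDrop T H,
    ∏ G ∈ T, ∑ i ∈ Finset.Ico 1 (M.rkDrop T G), PowerSeries.X ^ i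

theorem IsProductFamily.hilbertSeries_eq (h : M.IsProductFamily 𝒢) (hM : M.Loopless) :
    M.hilbertSeries 𝒢 = M.nestedSeries 𝒢 := by
  have he := h.isChowExponent hM
  have h1 : M.hilbertSeries 𝒢 = PowerSeries.mk fun n =>
      (({m : {G // G ∈ 𝒢} →₀ ℕ | m ∈ stdExponents (fun (S : Finset {G // G ∈ 𝒢})
        (G : {G // G ∈ 𝒢}) => M.rkDrop (S.image Subtype.val) G.1) Finset.univ ∅ ∧
          m.degree = n}.ncard : ℕ) : ℚ) := by
    rw [hilbertSeries]
    congr 1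
    ext n
    rw [← he.finrank_map_homogeneousSubmodule ℚ n]
    have key : ∀ I J : Ideal (MvPolynomial {G // G ∈ 𝒢} ℚ), I = J →
        Module.finrank ℚ ((MvPolynomial.homogeneousSubmodule {G // G ∈ 𝒢} ℚ n).map
          (Ideal.Quotient.mkₐ ℚ I).toLinearMap) =
        Module.finrank ℚ ((MvPolynomial.homogeneousSubmodule {G // G ∈ 𝒢} ℚ n).map
          (Ideal.Quotient.mkₐ ℚ J).toLinearMap) := by
      rintro I _ rfl
      rfl
    exact congrArg _ (key _ _ chowIdeal_eq_relIdeal)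
  have himg : ∀ T ⊆ 𝒢, (T.subtype (· ∈ 𝒢)).image Subtype.val = T := by
    intro T hT
    ext G
    simpa using fun hG => hT hG
  rw [h1, sum_ncard_stdExponents, nestedSeries]
  refine Finset.sum_bij' (fun S _ => S.image Subtype.val) (fun T _ => T.subtype (· ∈ 𝒢))
    ?_ ?_ ?_ ?_ ?_
  · intro S hS
    rw [Finset.mem_filter] at hS ⊢
    refine ⟨Finset.mem_powerset.2 fun G hG => ?_, fun H hH => hS.2 ⟨H, hH⟩⟩
    obtain ⟨G, -, rfl⟩ := Finset.mem_image.1 hG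
    exact G.2
  · intro T hT
    rw [Finset.mem_filter, Finset.mem_powerset] at hT
    refine Finset.mem_filter.2 ⟨Finset.mem_univ _, fun H => ?_⟩
    rw [himg T hT.1]
    exact hT.2 _ H.2
  · intro S _
    ext G
    simp
  · intro T hT
    rw [Finset.mem_filter, Finset.mem_powerset] at hT
    exact himg T hT.1
  · intro S _
    rw [Finset.prod_image fun _ _ _ _ h => Subtype.ext h]

end Polymatroid

/-! ### Möbius functions of intervals -/

section Moebius

/-- By `hf` the embedding matches the intervals `[a, b]` and `[f a, f b]`, on which the recursion
for the Möbius function depends. -/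
theorem IncidenceAlgebra.mu_map_orderEmbedding {P Q : Type*} [PartialOrder P] [PartialOrder Q]
    [LocallyFiniteOrder P] [LocallyFiniteOrder Q] [DecidableEq P] [DecidableEq Q]
    (k : Type*) [Ring k] (f : P ↪o Q) (hf : ∀ a b q, f a ≤ q → q ≤ f b → q ∈ Set.range f)
    (a b : P) : IncidenceAlgebra.mu k (f a) (f b) = IncidenceAlgebra.mu k a b := by
  induction hn : (Finset.Icc a b).card using Nat.strong_induction_on generalizing b with
  | _ n ih =>
    have hIco : Finset.Ico (f a) (f b) = (Finset.Ico a b).map f.toEmbedding := by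
      ext q
      simp only [Finset.mem_Ico, Finset.mem_map, RelEmbedding.coe_toEmbedding]
      constructor
      · rintro ⟨h1, h2⟩
        obtain ⟨p, rfl⟩ := hf a b q h1 h2.le
        exact ⟨p, ⟨f.le_iff_le.1 h1, f.lt_iff_lt.1 h2⟩, rfl⟩
      · rintro ⟨p, ⟨h1, h2⟩, rfl⟩
        exact ⟨f.le_iff_le.2 h1, f.lt_iff_lt.2 h2⟩
    rw [IncidenceAlgebra.mu_apply, IncidenceAlgebra.mu_apply a b, hIco, Finset.sum_map]
    simp only [f.injective.eq_iff, RelEmbedding.coe_toEmbedding]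
    congr 2
    refine Finset.sum_congr rfl fun x hx => ih _ ?_ x rfl
    rw [Finset.mem_Ico] at hx
    rw [← hn]
    refine Finset.card_lt_card ⟨Finset.Icc_subset_Icc le_rfl hx.2.le, fun hsub => ?_⟩
    exact absurd (Finset.mem_Icc.1 (hsub (Finset.mem_Icc.2 ⟨hx.1.trans hx.2.le, le_rfl⟩))).2
      hx.2.not_ge

end Moebius

/-! ### Characteristic polynomials of intervals and their factorization -/

namespace Polymatroid

variable {α : Type*} [DecidableEq α] {M : Polymatroid α} {𝒢 : Finset (Finset α)}
  {A F G H K X : Finset α}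

variable (M) in
/-- The finite set of flats. -/
def flats : Finset (Finset α) := M.ground.powerset.filter M.IsFlat

theorem mem_flats : F ∈ M.flats ↔ M.IsFlat F := by
  simp only [flats, Finset.mem_filter, Finset.mem_powerset, and_iff_right_iff_imp]
  exact fun h => h.1

theorem sum_flat {R : Type*} [AddCommMonoid R] (p : Finset α → Prop) [DecidablePred p]
    (u : Finset α → R) :
    ∑ F : M.Flat with p F.1, u F.1 = ∑ F ∈ M.flats with p F, u F := by
  refine Finset.sum_bij (fun F _ => F.1) (fun F hF => ?_) (fun F _ K _ h => Subtype.ext h)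
    (fun F hF => ?_) fun _ _ => rfl
  · rw [Finset.mem_filter] at hF ⊢
    exact ⟨mem_flats.2 F.2, hF.2⟩
  · rw [Finset.mem_filter] at hF
    exact ⟨⟨F, mem_flats.1 hF.1⟩, by simpa using hF.2, rfl⟩

variable (M) in
/-- The characteristic polynomial of the interval `[A, G]` in the lattice of flats. -/
noncomputable def intervalCharPoly (G A : Finset α) : Polynomial ℚ :=
  if hA : M.IsFlat A then
    ∑ K : M.Flat with A ⊆ K.1 ∧ K.1 ⊆ G, Polynomial.C (IncidenceAlgebra.mu ℚ ⟨A, hA⟩ K) *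
      Polynomial.X ^ (M.rk G - M.rk K.1)
  else 0

/-- This places the characteristic polynomials of all contractions in the one lattice of flats of
`M`, where Möbius inversion can act on them. -/
theorem charPoly_contract (F : M.Flat) :
    (M.contract F).charPoly = M.intervalCharPoly M.ground F.1 := by
  rw [intervalCharPoly, dif_pos F.2, charPoly, botFlat_of_loopless _ (loopless_contract F)]
  have hinj : ∀ X Y : (M.contract F).Flat, X.1 ∪ F.1 ⊆ Y.1 ∪ F.1 ↔ X.1 ⊆ Y.1 := by
    refine fun X Y => ⟨fun h x hx => ?_, Finset.union_subset_union_left⟩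
    exact (Finset.mem_union.1 (h (Finset.mem_union_left _ hx))).resolve_right
      (Finset.disjoint_left.1 (isFlat_contract.1 X.2).1 hx)
  let f : (M.contract F).Flat ↪o M.Flat :=
    OrderEmbedding.ofMapLEIff (fun X => ⟨X.1 ∪ F.1, (isFlat_contract.1 X.2).2⟩) hinj
  have hrange : ∀ (K : M.Flat) (h : F.1 ⊆ K.1),
      f ⟨K.1 \ F.1, isFlat_contract_sdiff K.2 h⟩ = K := fun K h =>
    Subtype.ext (Finset.sdiff_union_of_subset h)
  have hfF : f ⟨∅, loopless_contract F⟩ = F := Subtype.ext (Finset.empty_union _)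
  have hmu : ∀ X, IncidenceAlgebra.mu ℚ (⟨∅, loopless_contract F⟩ : (M.contract F).Flat) X
      = IncidenceAlgebra.mu ℚ F (f X) := fun X => by
    rw [← IncidenceAlgebra.mu_map_orderEmbedding ℚ f, hfF]
    rintro a b q h -
    exact ⟨_, hrange q (Finset.Subset.trans Finset.subset_union_right h)⟩
  refine Finset.sum_bij (fun X _ => f X) (fun X _ => ?_) (fun _ _ _ _ h => f.injective h)
    (fun K hK => ?_) fun X _ => ?_
  · rw [Finset.mem_filter]
    exact ⟨Finset.mem_univ _, Finset.subset_union_right, (f X).2.1⟩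
  · exact ⟨_, Finset.mem_univ _, hrange K (Finset.mem_filter.1 hK).2.1⟩
  · rw [hmu]
    congr 2
    have h1 := M.rk_mono F.1 (f X).1 Finset.subset_union_right (f X).2.1
    have h2 := M.rk_mono F.1 M.ground F.2.1 subset_rfl
    have h3 : (M.contract F).rk (M.contract F).ground = M.rk M.ground - M.rk F.1 :=
      contract_rk_sdiff F.2.1
    have h4 : (M.contract F).rk X.1 = M.rk (f X).1 - M.rk F.1 := rfl
    omega

/-- Möbius inversion for the characteristic polynomials of the intervals ending at `G`. -/
theorem sum_intervalCharPoly (hA : M.IsFlat A) (hAG : A ⊆ G) :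
    ∑ F ∈ M.flats with A ⊆ F ∧ F ⊆ G, M.intervalCharPoly G F =
      Polynomial.X ^ (M.rk G - M.rk A) := by
  rw [← sum_flat]
  have h1 : ∀ F : M.Flat, M.intervalCharPoly G F.1 = ∑ K : M.Flat, if F ≤ K ∧ K.1 ⊆ G then
      Polynomial.C (IncidenceAlgebra.mu ℚ F K) * Polynomial.X ^ (M.rk G - M.rk K.1) else 0 := by
    intro F
    rw [intervalCharPoly, dif_pos F.2, Finset.sum_filter]
    rfl
  simp only [h1]
  -- With the sums exchanged, the coefficient at `K` is the sum of `μ(F, K)` over `A ≤ F ≤ K`, which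
  -- vanishes unless `K = A`.
  rw [Finset.sum_comm, Finset.sum_eq_single ⟨A, hA⟩]
  · rw [Finset.sum_eq_single ⟨A, hA⟩]
    · rw [if_pos ⟨le_rfl, hAG⟩]
      simp
    · intro F hF hne
      rw [if_neg]
      rintro ⟨h, -⟩
      exact hne (le_antisymm h (Finset.mem_filter.1 hF).2.1)
    · intro h
      exact absurd (Finset.mem_filter.2 ⟨Finset.mem_univ _, subset_rfl, hAG⟩) h
  · intro K _ hK
    by_cases hKG : K.1 ⊆ G
    · have h2 : ∑ F : M.Flat with A ⊆ F.1 ∧ F.1 ⊆ G, (if F ≤ K ∧ K.1 ⊆ G then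
          Polynomial.C (IncidenceAlgebra.mu ℚ F K) * Polynomial.X ^ (M.rk G - M.rk K.1) else 0) =
          Polynomial.C (∑ F ∈ Finset.Icc ⟨A, hA⟩ K, IncidenceAlgebra.mu ℚ F K) *
            Polynomial.X ^ (M.rk G - M.rk K.1) := by
        rw [map_sum, Finset.sum_mul, ← Finset.sum_filter, Finset.filter_filter]
        refine Finset.sum_congr ?_ fun _ _ => rfl
        ext F
        simp only [Finset.mem_filter, Finset.mem_univ, true_and, Finset.mem_Icc]
        constructor
        · rintro ⟨⟨h, -⟩, h', -⟩
          exact ⟨h, h'⟩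
        · rintro ⟨h, h'⟩
          exact ⟨⟨h, Finset.Subset.trans h' hKG⟩, h', hKG⟩
      rw [h2, IncidenceAlgebra.sum_Icc_mu_left, if_neg (Ne.symm hK), map_zero, zero_mul]
    · exact Finset.sum_eq_zero fun F _ => if_neg fun h => hKG h.2
  · intro h
    exact absurd (Finset.mem_univ _) h

theorem intervalCharPoly_self (hG : M.IsFlat G) : M.intervalCharPoly G G = 1 := by
  have h := sum_intervalCharPoly hG (subset_rfl (a := G))
  rw [Nat.sub_self, pow_zero] at h
  rw [← h, Finset.sum_eq_single G]
  · intro F hF hne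
    have := (Finset.mem_filter.1 hF).2
    exact absurd (this.2.antisymm this.1) hne
  · intro h
    exact absurd (Finset.mem_filter.2 ⟨mem_flats.2 hG, subset_rfl, subset_rfl⟩) h

/-- A function on flats is determined by its sums over upper intervals. -/
theorem eq_of_forall_sum_eq {R : Type*} [AddCommGroup R] {u v : Finset α → R}
    (h : ∀ A ∈ M.flats, ∑ F ∈ M.flats with A ⊆ F, u F = ∑ F ∈ M.flats with A ⊆ F, v F) :
    ∀ A ∈ M.flats, u A = v A := by
  intro A
  induction hn : (M.ground \ A).card using Nat.strong_induction_on generalizing A with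
  | _ n ih =>
    intro hA
    have hsplit : (M.flats.filter fun F => A ⊆ F) =
        insert A (M.flats.filter fun F => A ⊂ F) := by
      ext F
      simp only [Finset.mem_filter, Finset.mem_insert]
      constructor
      · rintro ⟨h1, h2⟩
        exact (eq_or_ne F A).imp id fun hne => ⟨h1, h2.ssubset_of_ne hne.symm⟩
      · rintro (rfl | ⟨h1, h2⟩)
        exacts [⟨hA, subset_rfl⟩, ⟨h1, h2.subset⟩]
    have hA' := h A hA
    rw [hsplit, Finset.sum_insert (by simp), Finset.sum_insert (by simp)] at hA'
    have : ∑ F ∈ M.flats with A ⊂ F, u F = ∑ F ∈ M.flats with A ⊂ F, v F := by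
      refine Finset.sum_congr rfl fun F hF => ?_
      obtain ⟨hF, hAF⟩ := Finset.mem_filter.1 hF
      refine ih _ ?_ F rfl hF
      rw [← hn]
      refine Finset.card_lt_card (Finset.ssubset_iff_subset_ne.2
        ⟨Finset.sdiff_subset_sdiff subset_rfl hAF.subset, fun heq => ?_⟩)
      obtain ⟨a, haF, haA⟩ := Finset.exists_of_ssubset hAF
      have : a ∈ M.ground \ F := heq ▸ Finset.mem_sdiff.2 ⟨(mem_flats.1 hF).1 haF, haA⟩
      exact (Finset.mem_sdiff.1 this).2 haF
    rw [this] at hA'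
    exact add_right_cancel hA'

namespace IsProductFamily

theorem restrictFamily_ground (h : M.IsProductFamily 𝒢) : restrictFamily 𝒢 M.ground = 𝒢 :=
  Finset.filter_true_of_mem fun G hG => (h.isFlat G hG).1

/-- Sums over upper intervals of functions which are products over the factors. -/
theorem sum_prod_inter (h : M.IsProductFamily 𝒢) (hA : M.IsFlat A) {R : Type*} [CommSemiring R]
    (u : Finset α → Finset α → R) :
    ∑ F ∈ M.flats with A ⊆ F, ∏ G ∈ factors 𝒢, u G (F ∩ G) =
      ∏ G ∈ factors 𝒢, ∑ F ∈ M.flats with A ∩ G ⊆ F ∧ F ⊆ G, u G F := by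
  rw [Finset.prod_sum]
  have hE := isFlat_ground (M := M)
  have hcl := h.cl_inter M.ground hE
  have hcli := fun (A : Finset α → Finset α) (G : Finset α) =>
    h.cl_biUnion_inter (A := A) (G := G) hE
  have hfac := fun G (hG : G ∈ factors (restrictFamily 𝒢 M.ground)) => h.factor_isFlat hG
  rw [h.restrictFamily_ground] at hcl hcli hfac
  -- A flat is matched with its tuple of traces on the factors: `cl_inter` gives injectivity,
  -- `cl_biUnion_inter` surjectivity.
  refine Finset.sum_bij (fun F _ G _ => F ∩ G) (fun F hF => ?_) (fun F hF K hK heq => ?_)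
    (fun p hp => ?_) fun F _ => ?_
  · obtain ⟨hF, hAF⟩ := Finset.mem_filter.1 hF
    rw [Finset.mem_pi]
    intro G hG
    exact Finset.mem_filter.2 ⟨mem_flats.2 ((mem_flats.1 hF).inter (hfac G hG)),
      Finset.inter_subset_inter_right hAF, Finset.inter_subset_right⟩
  · have hF := mem_flats.1 (Finset.mem_filter.1 hF).1
    have hK := mem_flats.1 (Finset.mem_filter.1 hK).1
    rw [← hcl F hF hF.1, ← hcl K hK hK.1]
    congr 1
    exact Finset.biUnion_congr rfl fun G hG => congrFun (congrFun heq G) hG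
  · rw [Finset.mem_pi] at hp
    have hp' := fun G hG => Finset.mem_filter.1 (hp G hG)
    set B : Finset α → Finset α := fun G => if hG : G ∈ factors 𝒢 then p G hG else ∅ with hB
    have hBp : ∀ G (hG : G ∈ factors 𝒢), B G = p G hG := fun G hG => by simp [hB, hG]
    refine ⟨M.cl ((factors 𝒢).biUnion B), Finset.mem_filter.2 ⟨mem_flats.2 (M.isFlat_cl _), ?_⟩,
      ?_⟩
    · rw [← hcl A hA hA.1]
      refine cl_mono (Finset.biUnion_subset.2 fun G hG => ?_)
      refine Finset.Subset.trans ?_ (Finset.subset_biUnion_of_mem B hG)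
      rw [hBp G hG]
      exact (hp' G hG).2.1
    · funext G hG
      rw [hcli B G (fun G hG => by rw [hBp G hG]; exact (hp' G hG).2.2)
        (fun G hG => by rw [hBp G hG]; exact mem_flats.1 (hp' G hG).1) hG, hBp G hG]
  · exact (Finset.prod_attach _ fun G => u G (F ∩ G)).symm

theorem rk_eq_sum_inter (h : M.IsProductFamily 𝒢) (hA : M.IsFlat A) :
    M.rk A = ∑ G ∈ factors 𝒢, M.rk (A ∩ G) := by
  have h1 := h.rk_biUnion isFlat_ground (A := fun G => A ∩ G) fun _ _ => Finset.inter_subset_right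
  rw [← rk_cl (Finset.biUnion_subset.2 fun _ _ => Finset.inter_subset_left.trans hA.1),
    h.cl_inter M.ground isFlat_ground A hA hA.1, h.restrictFamily_ground] at h1
  exact h1

theorem isFlat_of_mem_factors (h : M.IsProductFamily 𝒢) (hG : G ∈ factors 𝒢) : M.IsFlat G :=
  h.isFlat G (Finset.mem_filter.1 hG).1

/-- The characteristic polynomial of a contraction is the product over the factors. -/
theorem intervalCharPoly_ground (h : M.IsProductFamily 𝒢) (hA : M.IsFlat A) :
    M.intervalCharPoly M.ground A = ∏ G ∈ factors 𝒢, M.intervalCharPoly G (A ∩ G) := by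
  -- Both sides have the same sum over every upper interval, namely `x ^ (rk E - rk A)`, since ranks
  -- add over the factors.
  refine eq_of_forall_sum_eq (M := M) (u := M.intervalCharPoly M.ground)
    (v := fun A => ∏ G ∈ factors 𝒢, M.intervalCharPoly G (A ∩ G)) (fun A hA => ?_) A
    (mem_flats.2 hA)
  have hA := mem_flats.1 hA
  rw [h.sum_prod_inter hA M.intervalCharPoly]
  have h1 : (M.flats.filter fun F => A ⊆ F) = M.flats.filter fun F => A ⊆ F ∧ F ⊆ M.ground :=
    Finset.filter_congr fun F hF => ⟨fun h => ⟨h, (mem_flats.1 hF).1⟩, fun h => h.1⟩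
  rw [h1, sum_intervalCharPoly hA hA.1, Finset.prod_congr rfl fun G hG => sum_intervalCharPoly
    (hA.inter (h.isFlat_of_mem_factors hG)) Finset.inter_subset_right,
    Finset.prod_pow_eq_pow_sum, Finset.sum_tsub_distrib]
  · have h2 := h.rk_eq M.ground isFlat_ground
    rw [h.restrictFamily_ground] at h2
    rw [← h2, ← h.rk_eq_sum_inter hA]
  · intro G hG
    exact M.rk_mono _ _ Finset.inter_subset_right (h.isFlat_of_mem_factors hG).1

end IsProductFamily

end Polymatroid

/-! ### The cancellation: vanishing of the convolution over all flats -/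

namespace Polymatroid

open PowerSeries

variable {α : Type*} [DecidableEq α] {M : Polymatroid α} {𝒢 : Finset (Finset α)}
  {A F G H K : Finset α} {S T : Finset (Finset α)}

theorem constantCoeff_one_sub_X_ne_zero : constantCoeff (1 - X : PowerSeries ℚ) ≠ 0 := by simp

theorem inv_one_sub_X_mul : (1 - X : PowerSeries ℚ)⁻¹ * (1 - X) = 1 :=
  PowerSeries.inv_mul_cancel _ constantCoeff_one_sub_X_ne_zero

theorem inv_one_sub_X_pow (n : ℕ) :
    ((1 - X : PowerSeries ℚ) ^ n)⁻¹ = (1 - X : PowerSeries ℚ)⁻¹ ^ n := by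
  rw [PowerSeries.inv_eq_iff_mul_eq_one (by simp), ← mul_pow, inv_one_sub_X_mul, one_pow]

theorem sum_Ico_X_pow {d : ℕ} (hd : 0 < d) :
    ∑ i ∈ Finset.Ico 1 d, (X : PowerSeries ℚ) ^ i = -((1 - X)⁻¹ * (X ^ d - X)) := by
  have h : (∑ i ∈ Finset.Ico 1 d, (X : PowerSeries ℚ) ^ i) * (1 - X) = X - X ^ d := by
    have := geom_sum_Ico_mul_neg (X : PowerSeries ℚ) (Nat.one_le_iff_ne_zero.2 hd.ne')
    rwa [pow_one] at this
  calc _ = (∑ i ∈ Finset.Ico 1 d, (X : PowerSeries ℚ) ^ i) * ((1 - X)⁻¹ * (1 - X)) := by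
        rw [inv_one_sub_X_mul, mul_one]
    _ = _ := by linear_combination (1 - X : PowerSeries ℚ)⁻¹ * h

variable (M) in
/-- The contribution of the factor `G` to the sum of the reduced characteristic series over an
upper interval of flats starting at a flat which meets `G` in `A`. -/
noncomputable def factorSeries (G A : Finset α) : PowerSeries ℚ :=
  if A = G then 1 else (1 - X)⁻¹ * (X ^ (M.rk G - M.rk A) - X)

/-- Put `d = rk G - rk A`. The unweighted sum is `x ^ d`, and its term at `F = G` is `1`. For `A ≠
G`, dividing only the other terms by `1 - x` gives `1 + (x ^ d - 1) / (1 - x) = (x ^ d - x) / (1 -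
x)`. -/
theorem sum_intervalCharPoly_mul (hG : M.IsFlat G) (hA : M.IsFlat A) (hAG : A ⊆ G) :
    ∑ F ∈ M.flats with A ⊆ F ∧ F ⊆ G, (M.intervalCharPoly G F : PowerSeries ℚ) *
      (if F = G then 1 else (1 - X)⁻¹) = M.factorSeries G A := by
  have hGmem : G ∈ M.flats.filter fun F => A ⊆ F ∧ F ⊆ G :=
    Finset.mem_filter.2 ⟨mem_flats.2 hG, hAG, subset_rfl⟩
  have h1 : ∑ F ∈ M.flats with A ⊆ F ∧ F ⊆ G, (M.intervalCharPoly G F : PowerSeries ℚ)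
      = X ^ (M.rk G - M.rk A) := by
    have := congrArg (Polynomial.coeToPowerSeries.ringHom (R := ℚ)) (sum_intervalCharPoly hA hAG)
    simpa using this
  rw [factorSeries]
  split_ifs with h
  · subst h
    rw [Finset.sum_eq_single A]
    · simp [intervalCharPoly_self hA]
    · intro F hF hne
      have := (Finset.mem_filter.1 hF).2
      exact absurd (this.2.antisymm this.1) hne
    · exact fun h => absurd hGmem h
  · rw [← Finset.add_sum_erase _ _ hGmem, intervalCharPoly_self hG] at h1 ⊢
    have h2 : ∀ F ∈ (M.flats.filter fun F => A ⊆ F ∧ F ⊆ G).erase G,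
        (M.intervalCharPoly G F : PowerSeries ℚ) * (if F = G then 1 else (1 - X)⁻¹)
          = (M.intervalCharPoly G F : PowerSeries ℚ) * (1 - X)⁻¹ := fun F hF => by
      rw [if_neg (Finset.mem_erase.1 hF).1]
    rw [Finset.sum_congr rfl h2, ← Finset.sum_mul, if_pos rfl]
    rw [Polynomial.coe_one] at h1 ⊢
    linear_combination (1 - X : PowerSeries ℚ)⁻¹ * h1 - inv_one_sub_X_mul

variable (M 𝒢) in
/-- The quotient of the characteristic polynomial of `M/F` by the power of `1 - x` whose exponent is
the number of factors of `𝒢/F`. -/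
noncomputable def contractSeries (F : Finset α) : PowerSeries ℚ :=
  (M.intervalCharPoly M.ground F : PowerSeries ℚ) *
    (1 - X)⁻¹ ^ ((factors 𝒢).filter fun G => ¬ G ⊆ F).card

namespace IsProductFamily

theorem reducedCharSeries_contract (h : M.IsProductFamily 𝒢) (F : M.Flat) :
    (M.contract F).reducedCharSeries (M.contractFamily 𝒢 F.1) = -M.contractSeries 𝒢 F.1 := by
  have h1 := h.factors_contractFamily F isFlat_ground F.2.1
  have h2 : restrictFamily (M.contractFamily 𝒢 F.1) (M.ground \ F.1) = M.contractFamily 𝒢 F.1 :=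
    (h.contract F).restrictFamily_ground
  rw [h2, h.restrictFamily_ground] at h1
  have h3 := h.contract_injOn F isFlat_ground F.2.1
  rw [h.restrictFamily_ground] at h3
  rw [reducedCharSeries, contractSeries, charPoly_contract, h1, Finset.card_image_of_injOn h3,
    inv_one_sub_X_pow, neg_mul]

theorem contractSeries_eq_prod (h : M.IsProductFamily 𝒢) (hF : M.IsFlat F) :
    M.contractSeries 𝒢 F = ∏ G ∈ factors 𝒢, (M.intervalCharPoly G (F ∩ G) : PowerSeries ℚ) *
      (if F ∩ G = G then 1 else (1 - X)⁻¹) := by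
  have h1 := congrArg (Polynomial.coeToPowerSeries.ringHom (R := ℚ)) (h.intervalCharPoly_ground hF)
  simp only [map_prod, Polynomial.coeToPowerSeries.ringHom_apply] at h1
  rw [contractSeries, Finset.prod_mul_distrib, h1, ← Finset.prod_const, Finset.prod_filter]
  congr 1
  refine Finset.prod_congr rfl fun G _ => ?_
  simp only [Finset.inter_eq_right, ite_not]

theorem sum_contractSeries (h : M.IsProductFamily 𝒢) (hA : M.IsFlat A) :
    ∑ F ∈ M.flats with A ⊆ F, M.contractSeries 𝒢 F =
      ∏ G ∈ factors 𝒢, M.factorSeries G (A ∩ G) := by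
  rw [Finset.sum_congr rfl fun F hF =>
      h.contractSeries_eq_prod (mem_flats.1 (Finset.mem_filter.1 hF).1),
    h.sum_prod_inter hA fun G F => (M.intervalCharPoly G F : PowerSeries ℚ) *
      (if F = G then 1 else (1 - X)⁻¹)]
  exact Finset.prod_congr rfl fun G hG => sum_intervalCharPoly_mul (h.isFlat_of_mem_factors hG)
    (hA.inter (h.isFlat_of_mem_factors hG)) Finset.inter_subset_right

/-- Every member of `T` lies below some factor, so the join of `T` is assembled from these
coordinates, and the coordinates of a join of flats below the factors are unique. -/
theorem cl_biUnion_inter_factor (h : M.IsProductFamily 𝒢) (hT : T ⊆ 𝒢) (hG : G ∈ factors 𝒢) :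
    M.cl (T.biUnion id) ∩ G = if G ∈ T then G else M.supBelow T G := by
  set A : Finset α → Finset α := fun G => if G ∈ T then G else M.supBelow T G with hA
  have hTg : T.biUnion id ⊆ M.ground := Finset.biUnion_subset.2 fun K hK => (h.isFlat K (hT hK)).1
  have hfac : ∀ G ∈ factors 𝒢, M.IsFlat G := fun G hG => h.isFlat_of_mem_factors hG
  have hAf : ∀ G ∈ factors 𝒢, M.IsFlat (A G) := fun G hG => by
    simp only [hA]
    split_ifs
    exacts [hfac G hG, isFlat_supBelow]
  have hAG : ∀ G ∈ factors 𝒢, A G ⊆ G := fun G hG => by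
    simp only [hA]
    split_ifs
    exacts [subset_rfl, supBelow_subset_self (hfac G hG)]
  have hcl : M.cl (T.biUnion id) = M.cl ((factors 𝒢).biUnion A) := by
    have hAg : (factors 𝒢).biUnion A ⊆ M.ground :=
      Finset.biUnion_subset.2 fun G hG => (hAf G hG).1
    refine (cl_mono (Finset.biUnion_subset.2 fun K hK => ?_)).antisymm
      (cl_subset_cl (Finset.biUnion_subset.2 fun G hG => ?_))
    · obtain ⟨G, hG, hKG⟩ := exists_mem_factors_superset (hT hK)
      refine Finset.Subset.trans ?_ (Finset.subset_biUnion_of_mem A hG)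
      simp only [hA]
      split_ifs with hGT
      · exact hKG
      · exact subset_supBelow (hfac G hG) hK (hKG.ssubset_of_ne fun heq => hGT (heq ▸ hK))
    · simp only [hA]
      split_ifs with hGT
      · exact (Finset.subset_biUnion_of_mem id hGT).trans (subset_cl hTg)
      · exact supBelow_subset (M.isFlat_cl _) fun K hK _ =>
          (Finset.subset_biUnion_of_mem id hK).trans (subset_cl hTg)
  have key := h.cl_biUnion_inter (A := A) (G := G) isFlat_ground
  rw [h.restrictFamily_ground] at key
  rw [hcl, key hAG hAf hG]

/-- The subsets without `G` are paired with those containing it. As `G` is maximal in `𝒢`, inserting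
it changes no drop, so both members of a pair are admissible or neither is. -/
theorem sum_nested_eq_zero (h : M.IsProductFamily 𝒢) (hG : G ∈ factors 𝒢) :
    ∑ T ∈ 𝒢.powerset with ∀ H ∈ 𝒢, 0 < M.rkDrop T H,
      (∏ H ∈ T, ∑ i ∈ Finset.Ico 1 (M.rkDrop T H), (X : PowerSeries ℚ) ^ i) *
        ∏ H ∈ factors 𝒢, M.factorSeries H (M.cl (T.biUnion id) ∩ H) = 0 := by
  obtain ⟨hG𝒢, hmax⟩ := Finset.mem_filter.1 hG
  rw [Finset.sum_filter]
  set 𝒢' := 𝒢.erase G with h𝒢'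
  have hins : 𝒢 = insert G 𝒢' := (Finset.insert_erase hG𝒢).symm
  have hGn : G ∉ 𝒢' := Finset.notMem_erase _ _
  have hpow : 𝒢.powerset = (insert G 𝒢').powerset := by rw [← hins]
  rw [hpow, Finset.sum_powerset_insert hGn, ← Finset.sum_add_distrib]
  refine Finset.sum_eq_zero fun T hT => ?_
  have hT' : T ⊆ 𝒢' := Finset.mem_powerset.1 hT
  have hT𝒢 : T ⊆ 𝒢 := hT'.trans (Finset.erase_subset _ _)
  have hGT : G ∉ T := fun h => hGn (hT' h)
  have hdrop : ∀ H ∈ 𝒢, M.rkDrop (insert G T) H = M.rkDrop T H := fun H hH =>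
    rkDrop_congr fun K hKH => by
      rw [Finset.mem_insert, or_iff_right]
      rintro rfl
      exact hKH.ne (hmax H hH hKH.subset).symm
  have hcond : (∀ H ∈ 𝒢, 0 < M.rkDrop (insert G T) H) ↔ ∀ H ∈ 𝒢, 0 < M.rkDrop T H :=
    forall₂_congr fun H hH => by rw [hdrop H hH]
  rw [if_congr hcond rfl rfl]
  split_ifs with hN
  swap
  · simp
  have hGs : M.supBelow T G ≠ G := (rkDrop_pos_iff (h.isFlat G hG𝒢)).1 (hN G hG𝒢)
  rw [Finset.prod_insert hGT, hdrop G hG𝒢, ← Finset.mul_prod_erase _ _ hG,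
    ← Finset.mul_prod_erase (a := G) _ _ hG]
  have e1 : ∏ H ∈ T, ∑ i ∈ Finset.Ico 1 (M.rkDrop (insert G T) H), (X : PowerSeries ℚ) ^ i
      = ∏ H ∈ T, ∑ i ∈ Finset.Ico 1 (M.rkDrop T H), (X : PowerSeries ℚ) ^ i :=
    Finset.prod_congr rfl fun H hH => by rw [hdrop H (hT𝒢 hH)]
  have hinsT : insert G T ⊆ 𝒢 := Finset.insert_subset hG𝒢 hT𝒢
  have e2 : ∏ H ∈ (factors 𝒢).erase G, M.factorSeries H (M.cl ((insert G T).biUnion id) ∩ H)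
      = ∏ H ∈ (factors 𝒢).erase G, M.factorSeries H (M.cl (T.biUnion id) ∩ H) := by
    refine Finset.prod_congr rfl fun H hH => ?_
    obtain ⟨hne, hH⟩ := Finset.mem_erase.1 hH
    have hHmem := (Finset.mem_filter.1 hH).1
    rw [h.cl_biUnion_inter_factor hinsT hH, h.cl_biUnion_inter_factor hT𝒢 hH]
    have hsup : M.supBelow (insert G T) H = M.supBelow T H := by
      rw [supBelow, supBelow, Finset.filter_insert, if_neg]
      exact fun hGH => hGH.ne (hmax H hHmem hGH.subset).symm
    simp [hne, hsup]
  -- The term of `insert G T` has the truncated geometric series of `G` times factor series `1`; the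
  -- term of `T` has no such series, and its factor series is the negative of it.
  have e3 : M.factorSeries G (M.cl ((insert G T).biUnion id) ∩ G) = 1 := by
    rw [h.cl_biUnion_inter_factor hinsT hG, if_pos (Finset.mem_insert_self _ _), factorSeries,
      if_pos rfl]
  have e4 : M.factorSeries G (M.cl (T.biUnion id) ∩ G)
      = (1 - X)⁻¹ * (X ^ M.rkDrop T G - X) := by
    rw [h.cl_biUnion_inter_factor hT𝒢 hG, if_neg hGT, factorSeries, if_neg hGs, rkDrop]
  rw [e1, e2, e3, e4, sum_Ico_X_pow (hN G hG𝒢)]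
  ring

/-- Writing the sum over subsets of `𝒢` itself makes the flat `F` enter only through the condition
that it contain the join of `T`, so the sums over `F` and `T` can be exchanged. -/
theorem nestedSeries_restrict (h : M.IsProductFamily 𝒢) (F : M.Flat) :
    (M.restrict F).nestedSeries (restrictFamily 𝒢 F.1) =
      ∑ T ∈ 𝒢.powerset with (∀ H ∈ 𝒢, 0 < M.rkDrop T H) ∧ M.cl (T.biUnion id) ⊆ F.1,
        ∏ G ∈ T, ∑ i ∈ Finset.Ico 1 (M.rkDrop T G), (X : PowerSeries ℚ) ^ i := by
  have hdrop : ∀ T H, H ⊆ F.1 → (M.restrict F).rkDrop T H = M.rkDrop T H := by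
    intro T H hHF
    have : (M.restrict F).supBelow T H = M.supBelow T H :=
      cl_restrict (Finset.biUnion_subset.2 fun K hK =>
        (Finset.mem_filter.1 hK).2.subset.trans hHF)
    rw [rkDrop, this]
    rfl
  rw [nestedSeries]
  refine Finset.sum_congr ?_ fun T hT => ?_
  · ext T
    simp only [Finset.mem_filter, Finset.mem_powerset]
    constructor
    · rintro ⟨hT, hN⟩
      have hTF : ∀ K ∈ T, K ⊆ F.1 := fun K hK => (Finset.mem_filter.1 (hT hK)).2
      refine ⟨hT.trans (Finset.filter_subset _ _), fun H hH => ?_,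
        cl_subset F.2 (Finset.biUnion_subset.2 hTF)⟩
      by_cases hHF : H ⊆ F.1
      · rw [← hdrop T H hHF]
        exact hN H (Finset.mem_filter.2 ⟨hH, hHF⟩)
      -- For `H` not contained in `F` positivity is automatic: the join of members of `T` stays
      -- inside `F`.
      · rw [rkDrop_pos_iff (h.isFlat H hH)]
        exact fun heq => hHF (heq ▸ supBelow_subset F.2 fun K hK _ => hTF K hK)
    · rintro ⟨hT, hN, hTF⟩
      have hTg : T.biUnion id ⊆ M.ground :=
        Finset.biUnion_subset.2 fun K hK => (h.isFlat K (hT hK)).1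
      refine ⟨fun K hK => Finset.mem_filter.2 ⟨hT hK, ?_⟩, fun H hH => ?_⟩
      · exact ((Finset.subset_biUnion_of_mem id hK).trans (subset_cl hTg)).trans hTF
      · obtain ⟨hH, hHF⟩ := Finset.mem_filter.1 hH
        rw [hdrop T H hHF]
        exact hN H hH
  · obtain ⟨hT, -, hTF⟩ := Finset.mem_filter.1 hT
    have hTg : T.biUnion id ⊆ M.ground := Finset.biUnion_subset.2 fun K hK =>
      (h.isFlat K (Finset.mem_powerset.1 hT hK)).1
    refine Finset.prod_congr rfl fun G hG => ?_
    rw [hdrop T G (((Finset.subset_biUnion_of_mem id hG).trans (subset_cl hTg)).trans hTF)]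

theorem factors_nonempty (h : M.IsProductFamily 𝒢) (hM : M.Loopless) (hE : M.ground.Nonempty) :
    (factors 𝒢).Nonempty := by
  by_contra hcon
  have := h.rk_eq M.ground isFlat_ground
  rw [h.restrictFamily_ground, Finset.not_nonempty_iff_eq_empty.1 hcon, Finset.sum_empty] at this
  exact (hM.rk_pos hE subset_rfl).ne' this

theorem sum_hilbertSeries_mul_contractSeries (h : M.IsProductFamily 𝒢) (hM : M.Loopless)
    (hE : M.ground.Nonempty) :
    ∑ F : M.Flat, (M.restrict F).hilbertSeries (restrictFamily 𝒢 F.1) *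
      M.contractSeries 𝒢 F.1 = 0 := by
  obtain ⟨G, hG⟩ := h.factors_nonempty hM hE
  rw [← h.sum_nested_eq_zero hG]
  have h1 : ∀ F : M.Flat, (M.restrict F).hilbertSeries (restrictFamily 𝒢 F.1) =
      ∑ T ∈ 𝒢.powerset with ∀ H ∈ 𝒢, 0 < M.rkDrop T H, if M.cl (T.biUnion id) ⊆ F.1 then
        ∏ G ∈ T, ∑ i ∈ Finset.Ico 1 (M.rkDrop T G), (X : PowerSeries ℚ) ^ i else 0 := fun F => by
    rw [(h.restrict F).hilbertSeries_eq (hM.restrict F), h.nestedSeries_restrict,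
      ← Finset.filter_filter]
    exact Finset.sum_filter _ _
  simp only [h1, Finset.sum_mul]
  rw [Finset.sum_comm]
  refine Finset.sum_congr rfl fun T hT => ?_
  rw [← h.sum_contractSeries (M.isFlat_cl _), ← sum_flat, Finset.mul_sum, Finset.sum_filter]
  refine Finset.sum_congr rfl fun F _ => ?_
  rw [ite_mul, zero_mul]

end IsProductFamily

end Polymatroid

/-! ### Minors of minors and the two inverse matrices -/

namespace Polymatroid

variable {α : Type*} [DecidableEq α] {M : Polymatroid α} {𝒢 : Finset (Finset α)}
  {G K : Finset α}

theorem eq_of_ground_of_rk {N : Polymatroid α} (hg : M.ground = N.ground) (hr : M.rk = N.rk) :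
    M = N := by
  cases M
  cases N
  subst hg hr
  rfl

theorem contract_empty (hM : M.IsFlat ∅) : M.contract ⟨∅, hM⟩ = M :=
  eq_of_ground_of_rk (Finset.sdiff_empty) (by
    funext A
    change M.rk (A ∪ ∅) - M.rk ∅ = _
    rw [Finset.union_empty, M.rk_empty, Nat.sub_zero])

theorem IsProductFamily.contractFamily_empty (h : M.IsProductFamily 𝒢) :
    M.contractFamily 𝒢 ∅ = 𝒢 := by
  have h1 : (𝒢.filter fun G => ¬ G ⊆ ∅) = 𝒢 := Finset.filter_true_of_mem fun G hG h0 =>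
    (h.nonempty G hG).ne_empty (Finset.subset_empty.1 h0)
  rw [contractFamily, h1]
  conv_rhs => rw [← Finset.image_id (s := 𝒢)]
  refine Finset.image_congr fun G hG => ?_
  rw [Finset.union_empty, Finset.sdiff_empty, (h.isFlat G hG).cl_eq, id]

/-- The rank functions agree on all finite sets, even outside the ground set; hence an equality of
polymatroids, along which Hilbert series can be rewritten. -/
theorem contract_contract {A F : M.Flat} (h : A ≤ F) :
    (M.contract A).contract ⟨F.1 \ A.1, isFlat_contract_sdiff F.2 h⟩ = M.contract F := by
  refine eq_of_ground_of_rk ?_ ?_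
  · change (M.ground \ A.1) \ (F.1 \ A.1) = M.ground \ F.1
    ext x
    simp only [Finset.mem_sdiff]
    have : x ∈ A.1 → x ∈ F.1 := fun hx => h hx
    tauto
  · funext X
    change M.rk (X ∪ F.1 \ A.1 ∪ A.1) - M.rk A.1 - (M.rk (F.1 \ A.1 ∪ A.1) - M.rk A.1)
      = M.rk (X ∪ F.1) - M.rk F.1
    have hA := M.rk_mono A.1 F.1 h F.2.1
    rw [Finset.union_assoc, Finset.sdiff_union_of_subset h]
    omega

theorem sdiff_subset_sdiff_iff {A : M.Flat} (hG : M.IsFlat G) (hK : M.IsFlat K) (hAK : A.1 ⊆ K) :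
    M.cl (G ∪ A.1) \ A.1 ⊆ K \ A.1 ↔ G ⊆ K :=
  ⟨fun h => IsProductFamily.subset_of_sdiff_subset_sdiff hG h hAK, fun h =>
    Finset.sdiff_subset_sdiff (cl_subset hK (Finset.union_subset h hAK)) subset_rfl⟩

theorem IsProductFamily.contractFamily_contractFamily (h𝒢 : M.IsProductFamily 𝒢) {A F : M.Flat}
    (h : A ≤ F) : (M.contract A).contractFamily (M.contractFamily 𝒢 A.1) (F.1 \ A.1) =
      M.contractFamily 𝒢 F.1 := by
  have h' : A.1 ⊆ F.1 := h
  rw [contractFamily, contractFamily, Finset.filter_image, Finset.image_image, contractFamily,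
    Finset.filter_filter]
  have hfilter : (𝒢.filter fun G => ¬ G ⊆ A.1 ∧ ¬ M.cl (G ∪ A.1) \ A.1 ⊆ F.1 \ A.1) =
      𝒢.filter fun G => ¬ G ⊆ F.1 := Finset.filter_congr fun G hG => by
    rw [sdiff_subset_sdiff_iff (h𝒢.isFlat G hG) F.2 h]
    exact ⟨fun h => h.2, fun hGF => ⟨fun hGA => hGF (hGA.trans h'), hGF⟩⟩
  rw [hfilter]
  refine Finset.image_congr fun G hG => ?_
  have hGf := h𝒢.isFlat G (Finset.mem_filter.1 hG).1
  have hGA := Finset.union_subset hGf.1 A.2.1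
  simp only [Function.comp_apply]
  rw [← Finset.union_sdiff_distrib, cl_contract (Finset.union_subset M.cl_subset_ground F.2.1),
    Finset.union_assoc, Finset.union_eq_left.2 h', cl_cl_union hGA F.2.1, Finset.union_assoc,
    Finset.union_eq_right.2 h', sdiff_sdiff_left, Finset.sup_eq_union,
    Finset.union_sdiff_of_subset h']

theorem IsProductFamily.restrictFamily_contractFamily (h𝒢 : M.IsProductFamily 𝒢) {A F : M.Flat}
    (h : A ≤ F) : restrictFamily (M.contractFamily 𝒢 A.1) (F.1 \ A.1) =
      (M.restrict F).contractFamily (restrictFamily 𝒢 F.1) A.1 := by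
  rw [restrictFamily, contractFamily, Finset.filter_image, contractFamily, restrictFamily,
    Finset.filter_filter, Finset.filter_filter]
  have hfilter : (𝒢.filter fun G => ¬ G ⊆ A.1 ∧ M.cl (G ∪ A.1) \ A.1 ⊆ F.1 \ A.1) =
      𝒢.filter fun G => G ⊆ F.1 ∧ ¬ G ⊆ A.1 := Finset.filter_congr fun G hG => by
    rw [sdiff_subset_sdiff_iff (h𝒢.isFlat G hG) F.2 h, and_comm]
  rw [hfilter]
  refine Finset.image_congr fun G hG => ?_
  rw [cl_restrict (Finset.union_subset (Finset.mem_filter.1 hG).2.1 h)]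

variable (M) in
/-- The minor `(M|B)/A` for flats `A ≤ B`. -/
def minor (A B : M.Flat) (h : A ≤ B) : Polymatroid α :=
  (M.restrict B).contract ⟨A.1, isFlat_restrict.2 ⟨A.2, h⟩⟩

variable (M 𝒢) in
/-- The family induced on the minor `(M|B)/A`. -/
def minorFamily (A B : M.Flat) : Finset (Finset α) :=
  (M.restrict B).contractFamily (restrictFamily 𝒢 B.1) A.1

namespace IsProductFamily

theorem minor (h𝒢 : M.IsProductFamily 𝒢) {A B : M.Flat} (h : A ≤ B) :
    (M.minor A B h).IsProductFamily (M.minorFamily 𝒢 A B) :=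
  (h𝒢.restrict B).contract ⟨A.1, isFlat_restrict.2 ⟨A.2, h⟩⟩

theorem restrictFamily_minorFamily (h𝒢 : M.IsProductFamily 𝒢) {A F B : M.Flat} (hAF : A ≤ F)
    (hFB : F ≤ B) : restrictFamily (M.minorFamily 𝒢 A B) (F.1 \ A.1) = M.minorFamily 𝒢 A F := by
  have := (h𝒢.restrict B).restrictFamily_contractFamily
    (A := ⟨A.1, isFlat_restrict.2 ⟨A.2, Finset.Subset.trans hAF hFB⟩⟩)
    (F := ⟨F.1, isFlat_restrict.2 ⟨F.2, hFB⟩⟩) hAF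
  rw [factors_restrict_restrict (show F.1 ⊆ B.1 from hFB)] at this
  exact this

variable (M 𝒢) in
/-- The Hilbert series of the minors, as a matrix. -/
noncomputable def _root_.Polymatroid.hilbertMatrix : Matrix M.Flat M.Flat (PowerSeries ℚ) :=
  open Classical in fun A B =>
    if h : A ≤ B then (M.minor A B h).hilbertSeries (M.minorFamily 𝒢 A B) else 0

variable (M 𝒢) in
/-- The reduced characteristic series of the minors, as a matrix. -/
noncomputable def _root_.Polymatroid.charMatrix : Matrix M.Flat M.Flat (PowerSeries ℚ) :=
  open Classical in fun A B =>
    if h : A ≤ B then -(M.minor A B h).reducedCharSeries (M.minorFamily 𝒢 A B) else 0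

theorem _root_.Polymatroid.minorFamily_self (A : M.Flat) : M.minorFamily 𝒢 A A = ∅ := by
  rw [minorFamily, contractFamily, restrictFamily, Finset.filter_filter,
    Finset.filter_false_of_mem fun G _ h => h.2 h.1, Finset.image_empty]

theorem charMatrix_self (A : M.Flat) : M.charMatrix 𝒢 A A = 1 := by
  rw [charMatrix, dif_pos le_rfl, minorFamily_self, reducedCharSeries, Polymatroid.minor,
    charPoly_contract]
  have h1 : (M.restrict A).intervalCharPoly (M.restrict A).ground A.1 = 1 :=
    intervalCharPoly_self isFlat_ground
  rw [h1]
  simp [factors]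

theorem hilbertMatrix_self (h𝒢 : M.IsProductFamily 𝒢) (A : M.Flat) :
    M.hilbertMatrix 𝒢 A A = 1 := by
  rw [hilbertMatrix, dif_pos le_rfl, (h𝒢.minor le_rfl).hilbertSeries_eq (loopless_contract _),
    minorFamily_self]
  simp [nestedSeries]

/-- For `A < B` the entry at `(A, B)` is the vanishing sum for the minor `(M|B)/A`: its flats
correspond to the flats between `A` and `B`, and its own minors are minors of `M`. -/
theorem hilbertMatrix_mul_charMatrix (h𝒢 : M.IsProductFamily 𝒢) :
    M.hilbertMatrix 𝒢 * M.charMatrix 𝒢 = 1 := by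
  ext1 A B
  rw [Matrix.mul_apply, Matrix.one_apply]
  have hzero : ∀ F : M.Flat, ¬ (A ≤ F ∧ F ≤ B) →
      M.hilbertMatrix 𝒢 A F * M.charMatrix 𝒢 F B = 0 := by
    intro F hF
    rw [not_and_or] at hF
    rcases hF with hF | hF
    · rw [hilbertMatrix, dif_neg hF, zero_mul]
    · rw [charMatrix, dif_neg hF, mul_zero]
  split_ifs with heq
  · subst heq
    rw [Finset.sum_eq_single A]
    · rw [h𝒢.hilbertMatrix_self, charMatrix_self, mul_one]
    · exact fun F _ hne => hzero F fun h => hne (le_antisymm h.2 h.1)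
    · exact fun h => absurd (Finset.mem_univ A) h
  by_cases hAB : A ≤ B
  swap
  · exact Finset.sum_eq_zero fun F _ => hzero F fun h => hAB (h.1.trans h.2)
  have hground : (M.minor A B hAB).ground.Nonempty := by
    have : A < B := lt_of_le_of_ne hAB heq
    exact Finset.sdiff_nonempty.2 this.not_ge
  rw [← (h𝒢.minor hAB).sum_hilbertSeries_mul_contractSeries (loopless_contract _) hground]
  symm
  have hflat : ∀ F : (M.minor A B hAB).Flat, M.IsFlat (F.1 ∪ A.1) ∧ F.1 ∪ A.1 ⊆ B.1 := fun F =>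
    isFlat_restrict.1 (isFlat_contract.1 F.2).2
  have hsd : ∀ F : (M.minor A B hAB).Flat, (F.1 ∪ A.1) \ A.1 = F.1 := fun F => by
    rw [Finset.union_sdiff_right, Finset.sdiff_eq_self_of_disjoint (isFlat_contract.1 F.2).1]
  refine Finset.sum_of_injOn (fun F => ⟨F.1 ∪ A.1, (hflat F).1⟩) (fun F _ K _ heq => ?_)
    (fun _ _ => Finset.mem_coe.2 (Finset.mem_univ _)) (fun F _ hF => ?_) fun F _ => ?_
  · refine Subtype.ext ?_
    rw [← hsd F, ← hsd K]
    exact congrArg (fun X : M.Flat => X.1 \ A.1) heq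
  · refine hzero F fun h => hF ?_
    have h1 : (M.minor A B hAB).IsFlat (F.1 \ A.1) :=
      isFlat_contract_sdiff (isFlat_restrict.2 ⟨F.2, h.2⟩) h.1
    exact ⟨⟨F.1 \ A.1, h1⟩, by simp, Subtype.ext (Finset.sdiff_union_of_subset h.1)⟩
  · obtain ⟨hF1, hF2⟩ := hflat F
    have hAF : A ≤ ⟨F.1 ∪ A.1, hF1⟩ := Finset.subset_union_right (s₁ := F.1)
    have hFB : ⟨F.1 ∪ A.1, hF1⟩ ≤ B := hF2
    rw [hilbertMatrix, charMatrix, dif_pos hAF, dif_pos hFB]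
    have e1 : (M.minor A B hAB).restrict F = M.minor A ⟨F.1 ∪ A.1, hF1⟩ hAF :=
      eq_of_ground_of_rk (hsd F).symm rfl
    have e2 : restrictFamily (M.minorFamily 𝒢 A B) F.1 =
        M.minorFamily 𝒢 A ⟨F.1 ∪ A.1, hF1⟩ := by
      rw [← h𝒢.restrictFamily_minorFamily hAF hFB, hsd F]
    have hF : F = ⟨(F.1 ∪ A.1) \ A.1, (hsd F).symm ▸ F.2⟩ := Subtype.ext (hsd F).symm
    have e3 : (M.minor A B hAB).contract F = M.minor ⟨F.1 ∪ A.1, hF1⟩ B hFB := by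
      exact (congrArg (M.minor A B hAB).contract hF).trans (contract_contract (M := M.restrict B)
        (F := ⟨F.1 ∪ A.1, isFlat_restrict.2 ⟨hF1, hF2⟩⟩) hAF)
    have e4 : (M.minor A B hAB).contractFamily (M.minorFamily 𝒢 A B) F.1 =
        M.minorFamily 𝒢 ⟨F.1 ∪ A.1, hF1⟩ B := by
      have := (h𝒢.restrict B).contractFamily_contractFamily
        (A := ⟨A.1, isFlat_restrict.2 ⟨A.2, hAB⟩⟩)
        (F := ⟨F.1 ∪ A.1, isFlat_restrict.2 ⟨hF1, hF2⟩⟩) hAF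
      simp only [hsd F] at this
      exact this
    rw [← e1, ← e2, ← e3, ← e4, (h𝒢.minor hAB).reducedCharSeries_contract, neg_neg]

/-- A one-sided inverse of a finite square matrix over a commutative ring is two-sided. This yields
the first recursion with no separate cancellation. -/
theorem charMatrix_mul_hilbertMatrix (h𝒢 : M.IsProductFamily 𝒢) :
    M.charMatrix 𝒢 * M.hilbertMatrix 𝒢 = 1 :=
  mul_eq_one_comm.1 h𝒢.hilbertMatrix_mul_charMatrix

end IsProductFamily

end Polymatroid

/-! ### The two recursions -/

open Polymatroid in
theorem theorem1p1 {α : Type*} [DecidableEq α] (M : Polymatroid α) (hM : M.Loopless)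
    (hE : M.ground.Nonempty) (𝒢 : Finset (Finset α)) (h𝒢 : M.IsBuildingSet 𝒢) :
    M.hilbertSeries 𝒢 =
        ∑ F ∈ Finset.univ.filter (fun F : M.Flat => F.1 ≠ ∅),
          (M.restrict F).reducedCharSeries (Polymatroid.restrictFamily 𝒢 F.1) *
            (M.contract F).hilbertSeries (M.contractFamily 𝒢 F.1) ∧
      M.hilbertSeries 𝒢 =
        ∑ F ∈ Finset.univ.filter (fun F : M.Flat => F.1 ≠ M.ground),
          (M.restrict F).hilbertSeries (Polymatroid.restrictFamily 𝒢 F.1) *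
            (M.contract F).reducedCharSeries (M.contractFamily 𝒢 F.1) := by
  have h := h𝒢.isProductFamily
  let b : M.Flat := ⟨∅, hM⟩
  let t : M.Flat := ⟨M.ground, isFlat_ground⟩
  have hne : b ≠ t := fun heq => hE.ne_empty (congrArg Subtype.val heq).symm
  have hb : ∀ F : M.Flat, b ≤ F := fun F => Finset.empty_subset _
  have ht : ∀ F : M.Flat, F ≤ t := fun F => F.2.1
  have hminb : ∀ F : M.Flat, M.minor b F (hb F) = M.restrict F := fun F => contract_empty _
  have hfamb : ∀ F : M.Flat, M.minorFamily 𝒢 b F = restrictFamily 𝒢 F.1 := fun F =>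
    (h.restrict F).contractFamily_empty
  have hmint : ∀ F : M.Flat, M.minor F t (ht F) = M.contract F := fun F => rfl
  have hfamt : ∀ F : M.Flat, M.minorFamily 𝒢 F t = M.contractFamily 𝒢 F.1 := fun F => by
    rw [minorFamily, h.restrictFamily_ground]
    rfl
  have hHb : ∀ F, M.hilbertMatrix 𝒢 b F = (M.restrict F).hilbertSeries (restrictFamily 𝒢 F.1) :=
    fun F => by rw [hilbertMatrix, dif_pos (hb F), hminb, hfamb]
  have hCb : ∀ F, M.charMatrix 𝒢 b F =
      -(M.restrict F).reducedCharSeries (restrictFamily 𝒢 F.1) :=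
    fun F => by rw [charMatrix, dif_pos (hb F), hminb, hfamb]
  have hHt : ∀ F, M.hilbertMatrix 𝒢 F t = (M.contract F).hilbertSeries (M.contractFamily 𝒢 F.1) :=
    fun F => by rw [hilbertMatrix, dif_pos (ht F), hmint, hfamt]
  have hCt : ∀ F, M.charMatrix 𝒢 F t =
      -(M.contract F).reducedCharSeries (M.contractFamily 𝒢 F.1) :=
    fun F => by rw [charMatrix, dif_pos (ht F), hmint, hfamt]
  have hbt : M.hilbertMatrix 𝒢 b t = M.hilbertSeries 𝒢 := by
    rw [hHb, h.restrictFamily_ground]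
    rfl
  constructor
  -- The entry at `(∅, E)` is off the diagonal because `E` is nonempty. Its term at `F = ∅` has
  -- diagonal factor `1` and is the Hilbert series itself; the minus sign built into `charMatrix`
  -- disappears on moving the rest across.
  · have hsum := congrFun (congrFun h.charMatrix_mul_hilbertMatrix b) t
    rw [Matrix.mul_apply, Matrix.one_apply_ne hne, ← Finset.add_sum_erase _ _ (Finset.mem_univ b),
      IsProductFamily.charMatrix_self, one_mul, hbt, ← eq_neg_iff_add_eq_zero,
      ← Finset.sum_neg_distrib] at hsum
    rw [hsum]
    refine Finset.sum_congr (by ext F; simp [b, Subtype.ext_iff]) fun F _ => ?_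
    rw [hCb, hHt, neg_mul, neg_neg]
  · have hsum := congrFun (congrFun h.hilbertMatrix_mul_charMatrix b) t
    rw [Matrix.mul_apply, Matrix.one_apply_ne hne, ← Finset.add_sum_erase _ _ (Finset.mem_univ t),
      IsProductFamily.charMatrix_self, mul_one, hbt, ← eq_neg_iff_add_eq_zero,
      ← Finset.sum_neg_distrib] at hsum
    rw [hsum]
    refine Finset.sum_congr (by ext F; simp [t, Subtype.ext_iff]) fun F _ => ?_
    rw [hHb, hCt, mul_neg, neg_neg]
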